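/- Let $d\ge 1$. On $\mathbb C^d$ use the norm $\|z\|=\sum_i|z_i|$ and write $z\cdot k=\sum_i z_ik_i$. For $r>0$ let $\mathcal D(r)=\{\theta\in\mathbb C^d:\|\operatorname{Im}\theta\|<r/2\pi\}$. Let $\mathcal A_d(r)$, respectively $\mathcal A_d'(r)$, be the Banach space of the analytic functions $f:\mathcal D(r)\to\mathbb C^d$, $1$-periodic in each variable, $f(\theta)=\sum_{k\in\mathbb Z^d}f_ke^{2\pi i k\cdot\theta}$, for which $$\|f\|_r=\sum_k\|f_k\|e^{r\|k\|},\quad\text{respectively}\quad \|f\|_r'=\sum_k(1+2\pi\|k\|)\|f_k\|e^{r\|k\|},$$ is finite. For $\sigma>0$ and $\omega\in\mathbb C^d$ let $I^-_\sigma(\omega)=\{k\in\mathbb Z^d:|\omega\cdot k|>\sigma\|k\|\}$, $I^+_\sigma(\omega)=\mathbb Z^d\setminus I^-_\sigma(\omega)$, and $[\mathbb I^\pm_\sigma(\omega)]f(\theta)=\sum_{k\in I^\pm_\sigma(\omega)}f_ke^{2\pi i k\cdot\theta}$. Let $0<\rho'<\rho$, $\omega\in\mathbb C^d\setminus\{0\}$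 and $0<\sigma<\|\omega\|$, and let $\hat B\subset\mathcal A_d'(\rho)$ be the open ball centred at the constant field $\omega$ with radius $$\hat\varepsilon=\frac{\sqrt6-2}{12}\,\sigma\,\min\Big\{\frac{\rho-\rho'}{4\pi},\ \frac{3-\sqrt6}{6}\,\frac{\sigma}{\|\omega\|}\Big\}.$$ Then for every $X\in\hat B$ there is an analytic map $U=U_X:\mathcal D(\rho')\to\mathcal D(\rho)$, biholomorphic onto its (open) image, with $DU$ invertible at every point, which is close to the identity in the sense that $U-\mathrm{id}\in\mathcal A_d'(\rho')$ and $$\|U-\mathrm{id}\|'_{\rho'}\le\frac{6(\sqrt6+2)}{\sigma}\,\|X-\omega\|'_\rho ,$$ such that $(DU)^{-1}\,X\circ U\in\mathcal A_d(\rho')$, $$[\mathbb I^-_\sigma(\omega)]\,(DU)^{-1}\,X\circ U=0,\qquad\text{and}\qquad U=\mathrm{id}\ \text{ if }\ [\mathbb I^-_\sigma(\omega)]X=0 .$$ The maps $U_X$ can be chosen so that, moreover, the map $\mathcal U:\hat B\to[\mathbb I^+_\sigma(\omega)]\mathcal A_d(\rho')$, $X\mapsto(DU_X)^{-1}\,X\circ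 U_X$, is analytic, its derivative at every constant vector field $\omega+\psi\in\hat B$ ($\psi\in\mathbb C^d$) is $\mathbb I^+_\sigma(\omega)$ (followed by restriction to $\mathcal D(\rho')$), and for all $X\in\hat B$ $$\|\mathcal U(X)-\omega\|_{\rho'}\le 2\Big(1+\max\Big\{\tfrac23(3-\sqrt6),\ 6(\sqrt6+2)\frac{\|\omega\|}{\sigma}\Big\}\Big)\|X-\omega\|'_\rho .$$ -/

import Mathlib

namespace TorusField

noncomputable section

/-- `ℂ^d` with the `ℓ₁`-norm `‖z‖ = ∑ |z_i|`. -/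
abbrev Vec (d : ℕ) : Type := PiLp 1 (fun _ : Fin d => ℂ)

/-- The `ℓ₁`-norm of an integer vector. -/
def freqNorm {d : ℕ} (k : Fin d → ℤ) : ℝ := ∑ i, |(k i : ℝ)|

/-- The bilinear product `z · k = ∑ z_i k_i`. -/
def dot {d : ℕ} (z : Vec d) (k : Fin d → ℤ) : ℂ := ∑ i, z i * (k i : ℂ)

/-- The complex neighbourhood `𝒟(r) = {θ ∈ ℂ^d : ‖Im θ‖ < r / 2π}` of `ℝ^d`. -/
def strip (d : ℕ) (r : ℝ) : Set (Vec d) :=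
  {θ | ∑ i, |(θ i).im| < r / (2 * Real.pi)}

/-- A point of `ℝ^d` as a point of `ℂ^d`. -/
def realPt {d : ℕ} (x : Fin d → ℝ) : Vec d := WithLp.toLp 1 fun i => (x i : ℂ)

/-- The character `θ ↦ e^{2πi k·θ}`. -/
def character {d : ℕ} (k : Fin d → ℤ) (θ : Vec d) : ℂ :=
  Complex.exp (2 * Real.pi * Complex.I * dot θ k)

/-- The Fourier coefficient `f_k = ∫_{(0,1]^d} e^{-2πi k·x} f(x) dx`. -/
def coeff {d : ℕ} (f : Vec d → Vec d) (k : Fin d → ℤ) : Vec d :=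
  ∫ x in {x : Fin d → ℝ | ∀ i, x i ∈ Set.Ioc (0 : ℝ) 1}, character (-k) (realPt x) • f (realPt x)

/-- The weight `(1 + 2π‖k‖)^j e^{r‖k‖}`; `j = 0` gives the norm `‖·‖_r`,
and `j = 1` gives the norm `‖·‖'_r`. -/
def weight {d : ℕ} (j : ℕ) (r : ℝ) (k : Fin d → ℤ) : ℝ :=
  (1 + 2 * Real.pi * freqNorm k) ^ j * Real.exp (r * freqNorm k)

/-- Functions `𝒟(r) → ℂ^d` (extended by `0` outside of `𝒟(r)`) that are holomorphic,
`1`-periodic in each variable, and have a finite weighted `ℓ₁`-sum of Fourier coefficients. -/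
structure IsField {d : ℕ} (j : ℕ) (r : ℝ) (f : Vec d → Vec d) : Prop where
  holo : DifferentiableOn ℂ f (strip d r)
  zero_off : ∀ θ, θ ∉ strip d r → f θ = 0
  periodic : ∀ (θ : Vec d) (n : Fin d → ℤ), f (θ + realPt fun i => (n i : ℝ)) = f θ
  summable : Summable fun k => weight j r k * ‖coeff f k‖

theorem weight_pos {d : ℕ} (j : ℕ) (r : ℝ) (k : Fin d → ℤ) : 0 < weight j r k := by
  have h : 0 ≤ freqNorm k := Finset.sum_nonneg fun i _ => abs_nonneg _
  unfold weight
  positivity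

theorem realPt_mem {d : ℕ} {r : ℝ} (hr : 0 < r) (x : Fin d → ℝ) : realPt x ∈ strip d r := by
  simp only [strip, realPt, Set.mem_ofPred_eq, Complex.ofReal_im, abs_zero, Finset.sum_const_zero]
  positivity

theorem strip_eq_empty {d : ℕ} {r : ℝ} (hr : r ≤ 0) (θ : Vec d) : θ ∉ strip d r := by
  simp only [strip, Set.mem_ofPred_eq, not_lt]
  exact (div_nonpos_of_nonpos_of_nonneg hr (by positivity)).trans
    (Finset.sum_nonneg fun i _ => abs_nonneg _)

theorem isOpen_strip (d : ℕ) (r : ℝ) : IsOpen (strip d r) := by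
  apply isOpen_lt _ continuous_const
  fun_prop

theorem continuous_realPt {d : ℕ} : Continuous (realPt : (Fin d → ℝ) → Vec d) := by
  unfold realPt
  fun_prop

theorem character_realPt {d : ℕ} (k : Fin d → ℤ) (x : Fin d → ℝ) :
    character k (realPt x) = UnitAddTorus.mFourier k fun i => (x i : UnitAddCircle) := by
  simp only [character, dot, realPt, UnitAddTorus.mFourier, ContinuousMap.coe_mk,
    fourier_coe_apply, Finset.mul_sum, Complex.exp_sum]
  refine Finset.prod_congr rfl fun i _ => ?_
  congr 1
  push_cast
  ring

theorem coeff_zero {d : ℕ} (k : Fin d → ℤ) : coeff (0 : Vec d → Vec d) k = 0 := by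
  simp [coeff]

theorem IsField.continuous_real {d j : ℕ} {r : ℝ} {f : Vec d → Vec d} (hf : IsField j r f) :
    Continuous fun x : Fin d → ℝ => f (realPt x) := by
  rcases le_or_gt r 0 with hr | hr
  · have : (fun x : Fin d → ℝ => f (realPt x)) = fun _ => 0 :=
      funext fun x => hf.zero_off _ (strip_eq_empty hr _)
    rw [this]
    exact continuous_const
  · exact hf.holo.continuousOn.comp_continuous continuous_realPt (realPt_mem hr)

theorem IsField.integrable {d j : ℕ} {r : ℝ} {f : Vec d → Vec d} (hf : IsField j r f)
    (k : Fin d → ℤ) :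
    MeasureTheory.IntegrableOn (fun x : Fin d → ℝ => character k (realPt x) • f (realPt x))
      {x : Fin d → ℝ | ∀ i, x i ∈ Set.Ioc (0 : ℝ) 1} := by
  have hc : Continuous fun x : Fin d → ℝ => character k (realPt x) • f (realPt x) := by
    have h1 : Continuous fun x : Fin d → ℝ => character k (realPt x) := by
      unfold character dot realPt
      fun_prop
    exact h1.smul hf.continuous_real
  refine (hc.continuousOn.integrableOn_compact
    (isCompact_Icc (a := (0 : Fin d → ℝ)) (b := 1))).mono_set ?_
  exact fun x hx => ⟨fun i => (hx i).1.le, fun i => (hx i).2⟩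

theorem IsField.coeff_add {d j : ℕ} {r : ℝ} {f g : Vec d → Vec d} (hf : IsField j r f)
    (hg : IsField j r g) (k : Fin d → ℤ) : coeff (f + g) k = coeff f k + coeff g k := by
  simp only [coeff, Pi.add_apply, smul_add]
  exact MeasureTheory.integral_add (hf.integrable _) (hg.integrable _)

theorem coeff_smul {d : ℕ} (c : ℂ) (f : Vec d → Vec d) (k : Fin d → ℤ) :
    coeff (c • f) k = c • coeff f k := by
  simp only [coeff, Pi.smul_apply, ← MeasureTheory.integral_smul]
  simp only [smul_comm c]

theorem IsField.zero {d j : ℕ} {r : ℝ} : IsField j r (0 : Vec d → Vec d) where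
  holo := differentiableOn_const 0
  zero_off _ _ := rfl
  periodic _ _ := rfl
  summable := by simp [coeff_zero, summable_zero]

theorem IsField.add {d j : ℕ} {r : ℝ} {f g : Vec d → Vec d} (hf : IsField j r f)
    (hg : IsField j r g) : IsField j r (f + g) where
  holo := hf.holo.add hg.holo
  zero_off θ h := by simp [hf.zero_off θ h, hg.zero_off θ h]
  periodic θ n := by simp [hf.periodic, hg.periodic]
  summable := by
    refine Summable.of_nonneg_of_le (fun k => mul_nonneg (weight_pos _ _ _).le (norm_nonneg _))
      (fun k => ?_) (hf.summable.add hg.summable)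
    rw [hf.coeff_add hg, ← mul_add]
    exact mul_le_mul_of_nonneg_left (norm_add_le _ _) (weight_pos _ _ _).le

theorem IsField.smul {d j : ℕ} {r : ℝ} {f : Vec d → Vec d} (c : ℂ) (hf : IsField j r f) :
    IsField j r (c • f) where
  holo := hf.holo.const_smul c
  zero_off θ h := by simp [hf.zero_off θ h]
  periodic θ n := by simp [hf.periodic]
  summable := by
    refine (hf.summable.mul_left ‖c‖).congr fun k => ?_
    rw [coeff_smul, norm_smul]
    ring

theorem IsField.real_eq_zero {d j : ℕ} {r : ℝ} {f : Vec d → Vec d} (hf : IsField j r f)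
    (h : ∀ k, coeff f k = 0) : ∀ x : Fin d → ℝ, f (realPt x) = 0 := by
  have hq : IsOpenQuotientMap
      (Pi.map fun (_ : Fin d) (t : ℝ) => (t : UnitAddCircle)) :=
    IsOpenQuotientMap.piMap fun _ => QuotientAddGroup.isOpenQuotientMap_mk
  intro x
  ext i
  have hc : Continuous fun x : Fin d → ℝ => f (realPt x) i :=
    (PiLp.proj (𝕜 := ℂ) 1 (fun _ : Fin d => ℂ) i).continuous.comp hf.continuous_real
  let F : C(Fin d → ℝ, ℂ) := ⟨fun x => f (realPt x) i, hc⟩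
  let Q : C(Fin d → ℝ, UnitAddTorus (Fin d)) := ⟨_, hq.continuous⟩
  have hQ : Topology.IsQuotientMap Q := hq.isQuotientMap
  have hF : Function.FactorsThrough F Q := by
    intro a b hab
    have hn : ∀ i, ∃ n : ℤ, a i = b i + n := by
      intro i
      have hi : (a i : UnitAddCircle) = (b i : UnitAddCircle) := congrFun hab i
      obtain ⟨n, hn⟩ := AddSubgroup.mem_zmultiples_iff.mp (QuotientAddGroup.eq.mp hi.symm)
      refine ⟨n, ?_⟩
      rw [zsmul_one] at hn
      linarith
    choose n hn using hn
    have : realPt a = realPt b + realPt fun i => (n i : ℝ) := by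
      ext i
      simp [realPt, hn]
    simp only [F, ContinuousMap.coe_mk, this, hf.periodic]
  let g : C(UnitAddTorus (Fin d), ℂ) := hQ.lift F hF
  have hg : ∀ x : Fin d → ℝ, g (fun i => (x i : UnitAddCircle)) = f (realPt x) i := by
    intro x
    exact congrArg (fun G : C(Fin d → ℝ, ℂ) => G x) (hQ.lift_comp F hF)
  have hco : UnitAddTorus.mFourierCoeff g = 0 := by
    funext k
    rw [UnitAddTorus.mFourierCoeff_eq_integral _ _ 0]
    have h1 := congrArg (PiLp.proj (𝕜 := ℂ) 1 (fun _ : Fin d => ℂ) i) (h k)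
    rw [coeff, ← ContinuousLinearMap.integral_comp_comm _ (hf.integrable _)] at h1
    simpa [hg, character_realPt] using h1
  have hs : Summable (UnitAddTorus.mFourierCoeff g) := by
    rw [hco]
    exact summable_zero
  have := UnitAddTorus.hasSum_mFourier_series_apply_of_summable hs
    (fun i => (x i : UnitAddCircle))
  rw [hco, hg] at this
  simpa using this.unique (by simp)

/-- A function of the space is determined by its Fourier coefficients. -/
theorem IsField.eq_zero {d j : ℕ} {r : ℝ} {f : Vec d → Vec d} (hf : IsField j r f)
    (h : ∀ k, coeff f k = 0) : f = 0 := by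
  have hreal := hf.real_eq_zero h
  funext z
  by_cases hz : z ∈ strip d r
  swap
  · exact hf.zero_off z hz
  let L : ℂ → Vec d := fun t => realPt (fun i => (z i).re) + t • realPt (fun i => (z i).im)
  let S : Set ℂ := L ⁻¹' strip d r
  have hL : Differentiable ℂ L := by
    intro t
    exact (differentiableAt_const _).add (differentiableAt_id.smul_const _)
  have hSo : IsOpen S := (isOpen_strip d r).preimage hL.continuous
  have hLim : ∀ t i, ((L t) i).im = t.im * (z i).im := by
    intro t i
    simp [L, realPt]
  have hr : 0 < r := by
    by_contra hr
    exact strip_eq_empty (not_lt.mp hr) z hz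
  have hSmem : ∀ t, t ∈ S ↔ |t.im| * ∑ i, |(z i).im| < r / (2 * Real.pi) := by
    intro t
    change ∑ i, |((L t) i).im| < _ ↔ _
    simp only [hLim, abs_mul, Finset.mul_sum]
  have hSc : IsPreconnected S := by
    apply Convex.isPreconnected
    intro s hs t ht a b ha hb hab
    rw [hSmem] at *
    have hM : 0 ≤ ∑ i, |(z i).im| := Finset.sum_nonneg fun i _ => abs_nonneg _
    have h1 : |(a • s + b • t).im| ≤ a * |s.im| + b * |t.im| := by
      have : (a • s + b • t).im = a * s.im + b * t.im := by simp
      rw [this]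
      refine (abs_add_le _ _).trans (le_of_eq ?_)
      rw [abs_mul, abs_mul, abs_of_nonneg ha, abs_of_nonneg hb]
    calc _ ≤ (a * |s.im| + b * |t.im|) * ∑ i, |(z i).im| :=
          mul_le_mul_of_nonneg_right h1 hM
      _ = a * (|s.im| * ∑ i, |(z i).im|) + b * (|t.im| * ∑ i, |(z i).im|) := by ring
      _ < r / (2 * Real.pi) := by
          rcases ha.eq_or_lt with rfl | ha'
          · have : b = 1 := by linarith
            subst this
            simpa using ht
          · have := mul_lt_mul_of_pos_left hs ha'
            have := mul_le_mul_of_nonneg_left ht.le hb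
            have : a * (r / (2 * Real.pi)) + b * (r / (2 * Real.pi)) = r / (2 * Real.pi) := by
              rw [← add_mul, hab, one_mul]
            linarith
  have hG : AnalyticOnNhd ℂ (f ∘ L) S :=
    (hf.holo.comp hL.differentiableOn fun t ht => ht).analyticOnNhd hSo
  have h0 : (0 : ℂ) ∈ S := by
    rw [hSmem]
    simp only [Complex.zero_im, abs_zero, zero_mul]
    positivity
  have hI : Complex.I ∈ S := by
    rw [hSmem]
    simpa [strip] using hz
  have hLr : ∀ s : ℝ, (f ∘ L) (s : ℂ) = 0 := by
    intro s
    have : L (s : ℂ) = realPt fun i => (z i).re + s * (z i).im := by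
      ext i
      simp [L, realPt]
    simp only [Function.comp_apply, this, hreal]
  have hfr : ∃ᶠ t in nhdsWithin (0 : ℂ) {0}ᶜ, (f ∘ L) t = 0 := by
    have ht : Filter.Tendsto (fun s : ℝ => (s : ℂ)) (nhdsWithin 0 {0}ᶜ)
        (nhdsWithin (0 : ℂ) {0}ᶜ) := by
      refine tendsto_nhdsWithin_iff.mpr ⟨?_, ?_⟩
      · exact (Complex.continuous_ofReal.tendsto' 0 0 (by simp)).mono_left nhdsWithin_le_nhds
      · filter_upwards [self_mem_nhdsWithin] with s hs
        simpa using hs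
    exact ht.frequently (Filter.Frequently.of_forall hLr)
  have := hG.eqOn_zero_of_preconnected_of_frequently_eq_zero hSc h0 hfr hI
  have hLI : L Complex.I = z := by
    ext i
    apply Complex.ext <;> simp [L, realPt]
  simpa [hLI] using this

/-- The space of the functions above: `𝒜_d(r)` for `j = 0` and `𝒜'_d(r)` for `j = 1`. -/
def FieldSpace (d j : ℕ) (r : ℝ) : Type :=
  ↥({ carrier := {f | IsField j r f}
      add_mem' := IsField.add
      zero_mem' := IsField.zero
      smul_mem' := fun c _ hf => IsField.smul c hf } : Submodule ℂ (Vec d → Vec d))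

instance (d j : ℕ) (r : ℝ) : AddCommGroup (FieldSpace d j r) :=
  inferInstanceAs (AddCommGroup ↥(Submodule.mk _ _ : Submodule ℂ (Vec d → Vec d)))

instance (d j : ℕ) (r : ℝ) : Module ℂ (FieldSpace d j r) :=
  inferInstanceAs (Module ℂ ↥(Submodule.mk _ _ : Submodule ℂ (Vec d → Vec d)))

instance (d j : ℕ) (r : ℝ) : CoeFun (FieldSpace d j r) fun _ => Vec d → Vec d :=
  ⟨fun f => f.1⟩

/-- The norm `∑_k (1 + 2π‖k‖)^j e^{r‖k‖} ‖f_k‖`. -/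
instance (d j : ℕ) (r : ℝ) : Norm (FieldSpace d j r) :=
  ⟨fun f => ∑' k, weight j r k * ‖coeff f k‖⟩

theorem FieldSpace.core (d j : ℕ) (r : ℝ) : NormedSpace.Core ℂ (FieldSpace d j r) where
  norm_nonneg f := tsum_nonneg fun k => mul_nonneg (weight_pos _ _ _).le (norm_nonneg _)
  norm_smul c f := by
    change ∑' k, weight j r k * ‖coeff (c • f.1) k‖ = ‖c‖ * ∑' k, weight j r k * ‖coeff f.1 k‖
    rw [← tsum_mul_left]
    refine tsum_congr fun k => ?_
    rw [coeff_smul, norm_smul]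
    ring
  norm_triangle f g := by
    change ∑' k, weight j r k * ‖coeff (f.1 + g.1) k‖ ≤
      ∑' k, weight j r k * ‖coeff f.1 k‖ + ∑' k, weight j r k * ‖coeff g.1 k‖
    have hf : IsField j r f.1 := f.2
    have hg : IsField j r g.1 := g.2
    rw [← hf.summable.tsum_add hg.summable]
    refine (hf.add hg).summable.tsum_le_tsum (fun k => ?_) (hf.summable.add hg.summable)
    rw [hf.coeff_add hg, ← mul_add]
    exact mul_le_mul_of_nonneg_left (norm_add_le _ _) (weight_pos _ _ _).le
  norm_eq_zero_iff f := by
    have hf : IsField j r f.1 := f.2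
    constructor
    · intro h
      have h' : ∀ k, weight j r k * ‖coeff f.1 k‖ = 0 := by
        have := (hasSum_zero_iff_of_nonneg
          (fun k => mul_nonneg (weight_pos j r k).le (norm_nonneg (coeff f.1 k)))).mp
          ((show ∑' k, weight j r k * ‖coeff f.1 k‖ = 0 from h) ▸ hf.summable.hasSum)
        exact fun k => congrFun this k
      refine Subtype.ext (hf.eq_zero fun k => ?_)
      simpa [(weight_pos j r k).ne'] using h' k
    · rintro rfl
      change ∑' k, weight j r k * ‖coeff (0 : Vec d → Vec d) k‖ = 0
      simp [coeff_zero]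

instance (d j : ℕ) (r : ℝ) : NormedAddCommGroup (FieldSpace d j r) :=
  NormedAddCommGroup.ofCore (FieldSpace.core d j r)

instance (d j : ℕ) (r : ℝ) : NormedSpace ℂ (FieldSpace d j r) :=
  NormedSpace.ofCore (FieldSpace.core d j r)

/-- `𝒜_d(r)` with the norm `∑_k ‖f_k‖ e^{r‖k‖}`. -/
abbrev A (d : ℕ) (r : ℝ) : Type := FieldSpace d 0 r

/-- `𝒜'_d(r)` with the norm `∑_k (1 + 2π‖k‖) ‖f_k‖ e^{r‖k‖}`. -/
abbrev A' (d : ℕ) (r : ℝ) : Type := FieldSpace d 1 r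

theorem isField_const {d : ℕ} (j : ℕ) (r : ℝ) (v : Vec d) :
    IsField j r ((strip d r).indicator fun _ => v) where
  holo := (differentiableOn_const v).congr fun θ h => Set.indicator_of_mem h _
  zero_off θ h := Set.indicator_of_notMem h _
  periodic θ n := by
    have : (θ + realPt fun i => (n i : ℝ)) ∈ strip d r ↔ θ ∈ strip d r := by
      simp [strip, realPt]
    by_cases h : θ ∈ strip d r
    · rw [Set.indicator_of_mem h, Set.indicator_of_mem (this.mpr h)]
    · rw [Set.indicator_of_notMem h, Set.indicator_of_notMem (mt this.mp h)]
  summable := by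
    rcases le_or_gt r 0 with hr | hr
    · have : (strip d r).indicator (fun _ => v) = 0 :=
        funext fun θ => Set.indicator_of_notMem (strip_eq_empty hr θ) _
      rw [this]
      exact IsField.zero.summable
    refine summable_of_ne_finset_zero (s := {0}) fun k hk => ?_
    have hk : k ≠ 0 := by simpa using hk
    have h1 : UnitAddTorus.mFourierCoeff (UnitAddTorus.mFourier (0 : Fin d → ℤ)) k = 0 := by
      have h0 := UnitAddTorus.mFourierBasis_repr (UnitAddTorus.mFourierBasis (0 : Fin d → ℤ)) k
      rw [HilbertBasis.repr_self, UnitAddTorus.coe_mFourierBasis] at h0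
      refine (UnitAddTorus.mFourierCoeff_toLp (UnitAddTorus.mFourier 0) k).symm.trans
        (h0.symm.trans ?_)
      simp [hk]
    rw [UnitAddTorus.mFourierCoeff_eq_integral _ _ 0] at h1
    have h2 : coeff ((strip d r).indicator fun _ => v) k = 0 := by
      simp only [coeff, Set.indicator_of_mem (realPt_mem hr _), integral_smul_const,
        character_realPt]
      simp only [UnitAddTorus.mFourier_zero, ContinuousMap.one_apply, smul_eq_mul, mul_one,
        Pi.zero_apply, zero_add] at h1
      rw [h1, zero_smul]
    rw [h2, norm_zero, mul_zero]

/-- The constant vector field `v` on `𝒟(r)`. -/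
def constField {d : ℕ} (j : ℕ) (r : ℝ) (v : Vec d) : FieldSpace d j r :=
  ⟨(strip d r).indicator fun _ => v, isField_const j r v⟩

/-- The indices of the far from resonance terms, `I⁻_σ(ψ) = {k : |ψ·k| > σ‖k‖}`. -/
def farIndices {d : ℕ} (σ : ℝ) (ψ : Vec d) : Set (Fin d → ℤ) :=
  {k | σ * freqNorm k < ‖dot ψ k‖}

/-- The indices of the resonant terms, `I⁺_σ(ψ) = ℤ^d \ I⁻_σ(ψ)`. -/
def resonantIndices {d : ℕ} (σ : ℝ) (ψ : Vec d) : Set (Fin d → ℤ) := (farIndices σ ψ)ᶜ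

/-- The Fourier projection `θ ↦ ∑_{k ∈ I} f_k e^{2πi k·θ}`; the projections
`𝕀^±_σ(ψ)` are those for `I = I^±_σ(ψ)`. -/
def fourierProj {d : ℕ} (I : Set (Fin d → ℤ)) (f : Vec d → Vec d) (θ : Vec d) : Vec d :=
  ∑' k : I, character k.1 θ • coeff f k.1

/-- `U` is an invertible analytic coordinate change from `S` into `T`: a biholomorphic map
of `S` onto its image, which lies in `T`. -/
structure IsCoordChange {d : ℕ} (U : Vec d → Vec d) (S T : Set (Vec d)) : Prop where
  mapsTo : Set.MapsTo U S T
  holo : DifferentiableOn ℂ U S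
  isOpen_image : IsOpen (U '' S)
  exists_inverse : ∃ V : Vec d → Vec d, DifferentiableOn ℂ V (U '' S) ∧ ∀ θ ∈ S, V (U θ) = θ

/-- The vector field `(DU)⁻¹ X ∘ U`. -/
def pullback {d : ℕ} (U X : Vec d → Vec d) (θ : Vec d) : Vec d :=
  (fderiv ℂ U θ).inverse (X (U θ))

/-- The radius `ε̂` of the ball of vector fields. -/
def radius (ρ ρ' σ w : ℝ) : ℝ :=
  (√6 - 2) / 12 * σ * min ((ρ - ρ') / (4 * Real.pi)) ((3 - √6) / 6 * (σ / w))

end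

end TorusField

open TorusField

/-! ### Frequencies, characters and Fourier series on strips. -/

namespace TorusField

noncomputable section

variable {d : ℕ}

/-! The coordinate change is found in one step, as a fixed point. Put `U = id + u` and let `J` be
the operator `g ↦ (Du) g`; the new field `N` must satisfy `(1 + J) N = X ∘ (id + u)`. Parametrize by
a field `w`: let `u` carry only far modes and solve `(Du) ω = 𝕀⁻ w`, and put `N = ω + 𝕀⁺ w = ω + w -
J ω`. The terms `J ω` cancel, and what remains is `w = (1 + J)⁻¹ (J² ω + (X - ω) ∘ (id + u))`, the
field `remainder`. Thus `u` has to be a fixed point of `solveOp` applied to `remainder`, and `N` is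
resonant by construction (`normalForm_add`, `projOp_normalForm`).

No derivative is lost. Since `|ω·k| > σ‖k‖` on far modes, division by `2πi ω·k` maps `𝒜` to `𝒜'`
with norm at most `2/σ` (`norm_solveOp_aux`), and `J` spends exactly the derivative gained
(`norm_jacobianOp_aux`). Only the composition consumes strip width. It multiplies the `k`-th mode by
`e^{2πi k·u}`; for `‖u‖ ≤ (r - s)/4π` half of the gap `e^{(r-s)‖k‖}` pays for this factor and the
other half for summation over `k`. Hence composition is a power series in `u` with values in bounded
operators (`hasFPowerSeriesOnBall_compOp`).

The fixed point map is holomorphic, sends the ball of radius `m` into that of radius `m/3`, and the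
latter into that of radius `m/6`. Cauchy's estimate turns these sizes into a contraction with
constant `3/4` (`norm_sub_le_of_bounds`), and the implicit function theorem makes the fixed point
analytic in `X` (`contDiffAt_fixedPoint`). Uniqueness forces `u = 0` when `X` has no far modes. The
derivative at constant fields comes from projecting the conjugacy equation
(`hasFDerivAt_normalForm`). Finally, `U` is biholomorphic because `u` has Lipschitz constant below
`1` (`isCoordChange_of_lipschitz`). -/

theorem freqNorm_nonneg (k : Fin d → ℤ) : 0 ≤ freqNorm k :=
  Finset.sum_nonneg fun _ _ => abs_nonneg _

theorem freqNorm_add_le (k l : Fin d → ℤ) : freqNorm (k + l) ≤ freqNorm k + freqNorm l := by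
  simp only [freqNorm, ← Finset.sum_add_distrib]
  refine Finset.sum_le_sum fun i _ => ?_
  rw [Pi.add_apply, Int.cast_add]
  exact abs_add_le _ _

theorem one_le_freqNorm {k : Fin d → ℤ} (hk : k ≠ 0) : 1 ≤ freqNorm k := by
  obtain ⟨i, hi⟩ := Function.ne_iff.mp hk
  have h1 : (1 : ℝ) ≤ |(k i : ℝ)| := by exact_mod_cast Int.one_le_abs hi
  exact h1.trans (Finset.single_le_sum (f := fun i => |(k i : ℝ)|)
    (fun _ _ => abs_nonneg _) (Finset.mem_univ i))

theorem dot_zero_right (z : Vec d) : dot z 0 = 0 := by simp [dot]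

theorem dot_add_right (z : Vec d) (k l : Fin d → ℤ) : dot z (k + l) = dot z k + dot z l := by
  simp [dot, mul_add, Finset.sum_add_distrib]

theorem dot_add_left (z w : Vec d) (k : Fin d → ℤ) : dot (z + w) k = dot z k + dot w k := by
  simp [dot, add_mul, Finset.sum_add_distrib]

theorem norm_dot_le (z : Vec d) (k : Fin d → ℤ) : ‖dot z k‖ ≤ freqNorm k * ‖z‖ := by
  rw [PiLp.norm_eq_of_L1, Finset.mul_sum]
  refine (norm_sum_le _ _).trans (Finset.sum_le_sum fun i _ => ?_)
  rw [norm_mul, mul_comm, Complex.norm_intCast]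
  exact mul_le_mul_of_nonneg_right (Finset.single_le_sum (f := fun i => |(k i : ℝ)|)
    (fun _ _ => abs_nonneg _) (Finset.mem_univ i)) (norm_nonneg _)

/-- The functional `z ↦ z · k`. -/
def dotL (k : Fin d → ℤ) : Vec d →L[ℂ] ℂ :=
  LinearMap.mkContinuous
    { toFun := fun z => dot z k
      map_add' := fun z w => dot_add_left z w k
      map_smul' := fun c z => by simp [dot, Finset.mul_sum, mul_assoc] }
    (freqNorm k) fun z => norm_dot_le z k

@[simp] theorem dotL_apply (k : Fin d → ℤ) (z : Vec d) : dotL k z = dot z k := rfl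

theorem norm_dotL_le (k : Fin d → ℤ) : ‖dotL k‖ ≤ freqNorm k :=
  LinearMap.mkContinuous_norm_le _ (freqNorm_nonneg k) _

theorem character_add (k l : Fin d → ℤ) (θ : Vec d) :
    character (k + l) θ = character k θ * character l θ := by
  rw [character, character, character, dot_add_right, mul_add, Complex.exp_add]

theorem character_zero (θ : Vec d) : character 0 θ = 1 := by simp [character, dot_zero_right]

theorem norm_character_le (k : Fin d → ℤ) (θ : Vec d) :
    ‖character k θ‖ ≤ Real.exp (2 * Real.pi * (∑ i, |(θ i).im|) * freqNorm k) := by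
  rw [character, Complex.norm_exp]
  apply Real.exp_le_exp.mpr
  have h1 : (2 * Real.pi * Complex.I * dot θ k).re = -(2 * Real.pi * (dot θ k).im) := by
    simp [Complex.mul_re]
  have h2 : (dot θ k).im = ∑ i, (θ i).im * k i := by
    simp [dot, Complex.mul_im]
  have h3 : |(dot θ k).im| ≤ (∑ i, |(θ i).im|) * freqNorm k := by
    rw [h2, Finset.sum_mul]
    refine (Finset.abs_sum_le_sum_abs _ _).trans (Finset.sum_le_sum fun i _ => ?_)
    rw [abs_mul]
    exact mul_le_mul_of_nonneg_left (Finset.single_le_sum (f := fun i => |(k i : ℝ)|)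
      (fun _ _ => abs_nonneg _) (Finset.mem_univ i)) (abs_nonneg _)
  rw [h1]
  nlinarith [neg_abs_le (dot θ k).im, Real.pi_pos]

/-- The `2π` in the width of the strip is matched to the weight `e^{r‖k‖}`; pointwise convergence of
the Fourier series rests on this bound. -/
theorem norm_character_le_of_mem {r : ℝ} {θ : Vec d} (hθ : θ ∈ strip d r) (k : Fin d → ℤ) :
    ‖character k θ‖ ≤ Real.exp (r * freqNorm k) := by
  refine (norm_character_le k θ).trans (Real.exp_le_exp.mpr ?_)
  refine mul_le_mul_of_nonneg_right ?_ (freqNorm_nonneg k)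
  have : ∑ i, |(θ i).im| < r / (2 * Real.pi) := hθ
  rw [lt_div_iff₀ (by positivity)] at this
  linarith

theorem exp_le_weight (j : ℕ) (r : ℝ) (k : Fin d → ℤ) :
    Real.exp (r * freqNorm k) ≤ weight j r k := by
  have h : 1 ≤ 1 + 2 * Real.pi * freqNorm k := by
    have := freqNorm_nonneg k
    have := Real.pi_pos
    have : 0 ≤ 2 * Real.pi * freqNorm k := by positivity
    linarith
  exact le_mul_of_one_le_left (Real.exp_nonneg _) (one_le_pow₀ h)

theorem norm_character_realPt (k : Fin d → ℤ) (x : Fin d → ℝ) :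
    ‖character k (realPt x)‖ = 1 := by
  rw [character, Complex.norm_exp, Real.exp_eq_one_iff]
  simp [dot, realPt, Complex.mul_re]

theorem continuous_character_realPt (k : Fin d → ℤ) :
    Continuous fun x : Fin d → ℝ => character k (realPt x) := by
  unfold character dot realPt
  fun_prop

theorem hasFDerivAt_character (k : Fin d → ℤ) (θ : Vec d) :
    HasFDerivAt (character k) ((2 * Real.pi * Complex.I * character k θ) • dotL k) θ := by
  have h := ((dotL k).hasFDerivAt (x := θ)).const_mul (2 * Real.pi * Complex.I)
  have h' := h.cexp
  convert! h' using 1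
  rw [smul_smul, mul_comm]
  rfl

theorem convex_strip (d : ℕ) (r : ℝ) : Convex ℝ (strip d r) := by
  have : ConvexOn ℝ Set.univ fun θ : Vec d => ∑ i, |(θ i).im| := by
    refine ⟨convex_univ, fun x _ y _ a b ha hb _ => ?_⟩
    simp only [smul_eq_mul, Finset.mul_sum, ← Finset.sum_add_distrib]
    refine Finset.sum_le_sum fun i _ => ?_
    have : ((a • x + b • y) i).im = a * (x i).im + b * (y i).im := by simp
    rw [this]
    refine (abs_add_le _ _).trans (le_of_eq ?_)
    rw [abs_mul, abs_mul, abs_of_nonneg ha, abs_of_nonneg hb]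
  simpa [strip] using this.convex_lt (r / (2 * Real.pi))

/-- The sum of the Fourier series with coefficients `a`. -/
def fourierSum (a : (Fin d → ℤ) → Vec d) (θ : Vec d) : Vec d := ∑' k, character k θ • a k

theorem summable_norm_character_smul {r : ℝ} {a : (Fin d → ℤ) → Vec d}
    (ha : Summable fun k => Real.exp (r * freqNorm k) * ‖a k‖) {θ : Vec d}
    (hθ : θ ∈ strip d r) : Summable fun k => ‖character k θ • a k‖ := by
  refine Summable.of_nonneg_of_le (fun _ => norm_nonneg _) (fun k => ?_) ha
  rw [norm_smul]
  exact mul_le_mul_of_nonneg_right (norm_character_le_of_mem hθ k) (norm_nonneg _)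

/-- The weight `e^{r‖k‖}` does not control the differentiated series on the whole strip. Around a
given point there is a narrower strip of parameter `s < r`, and there the gap `e^{(r-s)‖k‖}` absorbs
the factor `‖k‖`, so that termwise differentiation applies. -/
theorem hasFDerivAt_fourierSum {r : ℝ} {a : (Fin d → ℤ) → Vec d}
    (ha : Summable fun k => Real.exp (r * freqNorm k) * ‖a k‖) {θ : Vec d}
    (hθ : θ ∈ strip d r) :
    HasFDerivAt (fourierSum a)
      (∑' k, ((2 * Real.pi * Complex.I * character k θ) • dotL k).smulRight (a k)) θ := by
  have hθ' : ∑ i, |(θ i).im| < r / (2 * Real.pi) := hθ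
  obtain ⟨q, hq, hqr⟩ := exists_between hθ'
  have hπ := Real.pi_pos
  set s : ℝ := q * (2 * Real.pi) with hs
  have hsr : s < r := (lt_div_iff₀ (by positivity)).mp hqr
  have hmem : θ ∈ strip d s := by
    simpa [strip, hs, hπ.ne'] using hq
  have hss : strip d s ⊆ strip d r := fun z hz =>
    lt_of_lt_of_le (show ∑ i, |(z i).im| < s / (2 * Real.pi) from hz)
      (div_le_div_of_nonneg_right hsr.le (by positivity))
  refine hasFDerivAt_tsum_of_isPreconnected
    (u := fun k => 2 * Real.pi / (r - s) * (Real.exp (r * freqNorm k) * ‖a k‖))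
    (f := fun k θ => character k θ • a k)
    (f' := fun k θ => ((2 * Real.pi * Complex.I * character k θ) • dotL k).smulRight (a k))
    (ha.mul_left _) (isOpen_strip d s) (convex_strip d s).isPreconnected
    (fun k z _ => (hasFDerivAt_character k z).smul_const (a k)) (fun k z hz => ?_)
    hmem (summable_norm_character_smul ha hθ).of_norm hmem
  rw [ContinuousLinearMap.norm_smulRight_apply, norm_smul]
  have h1 : ‖(2 * Real.pi * Complex.I * character k z : ℂ)‖ = 2 * Real.pi * ‖character k z‖ := by
    simp [abs_of_pos hπ]
  rw [h1, ← mul_assoc (2 * Real.pi / (r - s))]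
  refine mul_le_mul_of_nonneg_right ?_ (norm_nonneg _)
  have h2 := norm_character_le_of_mem hz k
  have h3 := norm_dotL_le k
  have h4 : (r - s) * freqNorm k ≤ Real.exp ((r - s) * freqNorm k) := by
    linarith [Real.add_one_le_exp ((r - s) * freqNorm k)]
  have hrs : 0 < r - s := sub_pos.mpr hsr
  have h5 : freqNorm k ≤ Real.exp ((r - s) * freqNorm k) / (r - s) := by
    rw [le_div_iff₀ hrs]
    linarith
  calc _ ≤ 2 * Real.pi * Real.exp (s * freqNorm k) * freqNorm k := by gcongr
    _ ≤ 2 * Real.pi * Real.exp (s * freqNorm k) * (Real.exp ((r - s) * freqNorm k) / (r - s)) := by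
        gcongr
    _ = 2 * Real.pi / (r - s) * (Real.exp (s * freqNorm k) * Real.exp ((r - s) * freqNorm k)) := by
        ring
    _ = _ := by
        rw [← Real.exp_add]
        ring_nf

theorem integral_character (k : Fin d → ℤ) :
    ∫ x in {x : Fin d → ℝ | ∀ i, x i ∈ Set.Ioc (0 : ℝ) 1}, character k (realPt x) =
      if k = 0 then 1 else 0 := by
  have h1 : UnitAddTorus.mFourierCoeff (UnitAddTorus.mFourier (0 : Fin d → ℤ)) (-k) =
      if k = 0 then 1 else 0 := by
    have h0 := UnitAddTorus.mFourierBasis_repr (UnitAddTorus.mFourierBasis (0 : Fin d → ℤ)) (-k)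
    rw [HilbertBasis.repr_self, UnitAddTorus.coe_mFourierBasis] at h0
    refine (UnitAddTorus.mFourierCoeff_toLp (UnitAddTorus.mFourier 0) (-k)).symm.trans
      (h0.symm.trans ?_)
    by_cases hk : k = 0 <;> simp [hk]
  rw [UnitAddTorus.mFourierCoeff_eq_integral _ _ 0] at h1
  rw [← h1]
  simp [character_realPt, UnitAddTorus.mFourier_zero]

theorem coeff_congr {f g : Vec d → Vec d} (h : ∀ x, f (realPt x) = g (realPt x))
    (k : Fin d → ℤ) : coeff f k = coeff g k := by
  simp only [coeff, h]

/-- Absolute summability lets the integral pass through the sum, and orthogonality of the characters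
leaves one term. This is what allows fields to be built by prescribing coefficients. -/
theorem coeff_fourierSum {a : (Fin d → ℤ) → Vec d} (ha : Summable fun k => ‖a k‖)
    (l : Fin d → ℤ) : coeff (fourierSum a) l = a l := by
  set S : Set (Fin d → ℝ) := {x : Fin d → ℝ | ∀ i, x i ∈ Set.Ioc (0 : ℝ) 1} with hS
  have hint : ∀ k, MeasureTheory.IntegrableOn
      (fun x => character (k + -l) (realPt x) • a k) S := by
    intro k
    have hc : Continuous fun x : Fin d → ℝ => character (k + -l) (realPt x) • a k :=
      (continuous_character_realPt _).smul continuous_const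
    refine (hc.continuousOn.integrableOn_compact
      (isCompact_Icc (a := (0 : Fin d → ℝ)) (b := 1))).mono_set ?_
    exact fun x hx => ⟨fun i => (hx i).1.le, fun i => (hx i).2⟩
  have hsum := MeasureTheory.hasSum_integral_of_summable_integral_norm hint (by
    simp only [norm_smul, norm_character_realPt, one_mul, MeasureTheory.integral_const]
    exact ha.const_smul _)
  have h1 : (fun k => ∫ x in S, character (k + -l) (realPt x) • a k) =
      fun k => if k = l then a k else 0 := by
    funext k
    rw [integral_smul_const, integral_character]
    by_cases hk : k = l
    · simp [hk]
    · rw [if_neg hk, if_neg, zero_smul]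
      intro h
      exact hk (by simpa [← sub_eq_add_neg, sub_eq_zero] using h)
  have h2 : coeff (fourierSum a) l = ∫ x in S, ∑' k, character (k + -l) (realPt x) • a k := by
    refine MeasureTheory.integral_congr_ae (Filter.Eventually.of_forall fun x => ?_)
    simp only [fourierSum]
    rw [← tsum_const_smul'']
    refine tsum_congr fun k => ?_
    rw [smul_smul, character_add, mul_comm]
  rw [h2, ← hsum.tsum_eq, h1, tsum_ite_eq]

theorem strip_add_int (r : ℝ) (θ : Vec d) (n : Fin d → ℤ) :
    (θ + realPt fun i => (n i : ℝ)) ∈ strip d r ↔ θ ∈ strip d r := by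
  simp [strip, realPt]

theorem character_add_int (k : Fin d → ℤ) (θ : Vec d) (n : Fin d → ℤ) :
    character k (θ + realPt fun i => (n i : ℝ)) = character k θ := by
  rw [character, character, dot_add_left]
  have : dot (realPt fun i => (n i : ℝ)) k = ((∑ i, n i * k i : ℤ) : ℂ) := by
    simp [dot, realPt]
  rw [this, Complex.exp_eq_exp_iff_exists_int]
  exact ⟨∑ i, n i * k i, by ring⟩

theorem summable_exp_mul {j : ℕ} {r : ℝ} {a : (Fin d → ℤ) → Vec d}
    (ha : Summable fun k => weight j r k * ‖a k‖) :
    Summable fun k => Real.exp (r * freqNorm k) * ‖a k‖ :=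
  Summable.of_nonneg_of_le (fun _ => by positivity)
    (fun k => mul_le_mul_of_nonneg_right (exp_le_weight j r k) (norm_nonneg _)) ha

theorem summable_norm_of_weight {j : ℕ} {r : ℝ} (hr : 0 < r) {a : (Fin d → ℤ) → Vec d}
    (ha : Summable fun k => weight j r k * ‖a k‖) : Summable fun k => ‖a k‖ := by
  refine Summable.of_nonneg_of_le (fun _ => norm_nonneg _) (fun k => ?_) (summable_exp_mul ha)
  refine le_mul_of_one_le_left (norm_nonneg _) (Real.one_le_exp ?_)
  exact mul_nonneg hr.le (freqNorm_nonneg k)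

theorem coeff_indicator {r : ℝ} (hr : 0 < r) {a : (Fin d → ℤ) → Vec d}
    (ha : Summable fun k => ‖a k‖) (k : Fin d → ℤ) :
    coeff ((strip d r).indicator (fourierSum a)) k = a k := by
  rw [← coeff_fourierSum ha k]
  exact coeff_congr (fun x => Set.indicator_of_mem (realPt_mem hr x) _) k

theorem isField_fourierSum {j : ℕ} {r : ℝ} (hr : 0 < r) {a : (Fin d → ℤ) → Vec d}
    (ha : Summable fun k => weight j r k * ‖a k‖) :
    IsField j r ((strip d r).indicator (fourierSum a)) where
  holo θ hθ := ((hasFDerivAt_fourierSum (summable_exp_mul ha)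
    hθ).differentiableAt.differentiableWithinAt).congr
      (fun z hz => Set.indicator_of_mem hz _) (Set.indicator_of_mem hθ _)
  zero_off θ h := Set.indicator_of_notMem h _
  periodic θ n := by
    by_cases h : θ ∈ strip d r
    · rw [Set.indicator_of_mem h, Set.indicator_of_mem ((strip_add_int r θ n).mpr h)]
      simp only [fourierSum, character_add_int]
    · rw [Set.indicator_of_notMem h, Set.indicator_of_notMem (mt (strip_add_int r θ n).mp h)]
  summable := by
    simpa only [coeff_indicator hr (summable_norm_of_weight hr ha)] using ha

/-- The field with given Fourier coefficients. -/
def ofCoeff {j : ℕ} {r : ℝ} (hr : 0 < r) (a : (Fin d → ℤ) → Vec d)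
    (ha : Summable fun k => weight j r k * ‖a k‖) : FieldSpace d j r :=
  ⟨(strip d r).indicator (fourierSum a), isField_fourierSum hr ha⟩

theorem coeff_ofCoeff {j : ℕ} {r : ℝ} (hr : 0 < r) (a : (Fin d → ℤ) → Vec d)
    (ha : Summable fun k => weight j r k * ‖a k‖) (k : Fin d → ℤ) :
    coeff (ofCoeff hr a ha) k = a k :=
  coeff_indicator hr (summable_norm_of_weight hr ha) k

/-! ### Spaces of fields as weighted `ℓ₁` spaces: coefficients, evaluation, modes. -/

variable {j : ℕ} {r : ℝ}

theorem FieldSpace.isField (f : FieldSpace d j r) : IsField j r f := f.2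

theorem FieldSpace.norm_def (f : FieldSpace d j r) : ‖f‖ = ∑' k, weight j r k * ‖coeff f k‖ := rfl

theorem FieldSpace.coeff_add (f g : FieldSpace d j r) (k : Fin d → ℤ) :
    coeff (f + g) k = coeff f k + coeff g k := f.isField.coeff_add g.isField k

theorem weight_mul_norm_coeff_le (f : FieldSpace d j r) (k : Fin d → ℤ) :
    weight j r k * ‖coeff f k‖ ≤ ‖f‖ :=
  f.isField.summable.le_tsum k fun _ _ => mul_nonneg (weight_pos _ _ _).le (norm_nonneg _)

/-- The `k`-th Fourier coefficient as a continuous linear map. -/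
def coeffL (d j : ℕ) (r : ℝ) (k : Fin d → ℤ) : FieldSpace d j r →L[ℂ] Vec d :=
  LinearMap.mkContinuous
    { toFun := fun f => coeff f k
      map_add' := fun f g => f.coeff_add g k
      map_smul' := fun c f => coeff_smul c f k }
    (weight j r k)⁻¹ fun f => by
      rw [inv_mul_eq_div, le_div_iff₀ (weight_pos j r k), mul_comm]
      exact weight_mul_norm_coeff_le f k

@[simp] theorem coeffL_apply (k : Fin d → ℤ) (f : FieldSpace d j r) :
    coeffL d j r k f = coeff f k := rfl

theorem FieldSpace.ext_coeff {f g : FieldSpace d j r} (h : ∀ k, coeff f k = coeff g k) :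
    f = g := by
  rw [← sub_eq_zero]
  refine Subtype.ext ((f - g).isField.eq_zero fun k => ?_)
  rw [← coeffL_apply, map_sub, coeffL_apply, coeffL_apply, h, sub_self]

theorem FieldSpace.hasSum_apply (hr : 0 < r) (f : FieldSpace d j r) {θ : Vec d}
    (hθ : θ ∈ strip d r) : HasSum (fun k => character k θ • coeff f k) (f θ) := by
  have h : f = ofCoeff hr (coeff f) f.isField.summable :=
    FieldSpace.ext_coeff fun k => (coeff_ofCoeff hr _ _ k).symm
  have h' : f θ = fourierSum (coeff f) θ := by
    conv_lhs => rw [h]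
    exact Set.indicator_of_mem hθ _
  rw [h']
  exact (summable_norm_character_smul (summable_exp_mul f.isField.summable) hθ).of_norm.hasSum

theorem FieldSpace.norm_apply_le (hr : 0 < r) (f : FieldSpace d j r) {θ : Vec d}
    (hθ : θ ∈ strip d r) : ‖f θ‖ ≤ ‖f‖ := by
  rw [← (f.hasSum_apply hr hθ).tsum_eq]
  refine tsum_of_norm_bounded f.isField.summable.hasSum fun k => ?_
  rw [norm_smul]
  exact mul_le_mul_of_nonneg_right
    ((norm_character_le_of_mem hθ k).trans (exp_le_weight j r k)) (norm_nonneg _)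

/-- Evaluation at a point of the strip. -/
def evalL (j : ℕ) (hr : 0 < r) {θ : Vec d} (hθ : θ ∈ strip d r) : FieldSpace d j r →L[ℂ] Vec d :=
  LinearMap.mkContinuous
    { toFun := fun f => f θ
      map_add' := fun _ _ => rfl
      map_smul' := fun _ _ => rfl } 1 fun f => by
      rw [one_mul]
      exact f.norm_apply_le hr hθ

@[simp] theorem evalL_apply (hr : 0 < r) {θ : Vec d} (hθ : θ ∈ strip d r)
    (f : FieldSpace d j r) : evalL j hr hθ f = f θ := rfl

theorem FieldSpace.hasFDerivAt (hr : 0 < r) (f : FieldSpace d j r) {θ : Vec d}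
    (hθ : θ ∈ strip d r) :
    HasFDerivAt f (∑' k, ((2 * Real.pi * Complex.I * character k θ) • dotL k).smulRight
      (coeff f k)) θ := by
  refine (hasFDerivAt_fourierSum (summable_exp_mul f.isField.summable) hθ).congr_of_eventuallyEq ?_
  filter_upwards [(isOpen_strip d r).mem_nhds hθ] with z hz
  exact (f.hasSum_apply hr hz).tsum_eq.symm

theorem summable_weight_single (j : ℕ) (r : ℝ) (k : Fin d → ℤ) (v : Vec d) :
    Summable fun l => weight j r l * ‖(Pi.single k v : (Fin d → ℤ) → Vec d) l‖ :=
  summable_of_ne_finset_zero (s := {k}) fun l hl => by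
    have : l ≠ k := by simpa using hl
    simp [this]

/-- The field `v e^{2πi k·θ}`. -/
def mode (d j : ℕ) {r : ℝ} (hr : 0 < r) (k : Fin d → ℤ) : Vec d →L[ℂ] FieldSpace d j r :=
  LinearMap.mkContinuous
    { toFun := fun v => ofCoeff hr (Pi.single k v) (summable_weight_single j r k v)
      map_add' := fun v w => FieldSpace.ext_coeff fun l => by
        rw [FieldSpace.coeff_add, coeff_ofCoeff, coeff_ofCoeff, coeff_ofCoeff, Pi.single_add,
          Pi.add_apply]
      map_smul' := fun c v => FieldSpace.ext_coeff fun l => by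
        rw [← coeffL_apply, ← coeffL_apply, map_smul, coeffL_apply, coeffL_apply, coeff_ofCoeff,
          coeff_ofCoeff, RingHom.id_apply, Pi.single_smul, Pi.smul_apply] }
    (weight j r k) fun v => by
      refine le_of_eq ?_
      change ‖ofCoeff hr (Pi.single k v) (summable_weight_single j r k v)‖ = _
      rw [FieldSpace.norm_def, tsum_eq_single k]
      · rw [coeff_ofCoeff, Pi.single_eq_same]
      · intro l hl
        rw [coeff_ofCoeff, Pi.single_eq_of_ne hl, norm_zero, mul_zero]

theorem coeff_mode (hr : 0 < r) (k : Fin d → ℤ) (v : Vec d) (l : Fin d → ℤ) :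
    coeff (mode d j hr k v) l = (Pi.single k v : (Fin d → ℤ) → Vec d) l :=
  coeff_ofCoeff hr _ (summable_weight_single j r k v) l

theorem norm_mode_le (hr : 0 < r) (k : Fin d → ℤ) : ‖mode d j hr k‖ ≤ weight j r k :=
  LinearMap.mkContinuous_norm_le _ (weight_pos j r k).le _

theorem mode_apply (hr : 0 < r) (k : Fin d → ℤ) (v : Vec d) {θ : Vec d} (hθ : θ ∈ strip d r) :
    mode d j hr k v θ = character k θ • v := by
  rw [← ((mode d j hr k v).hasSum_apply hr hθ).tsum_eq, tsum_eq_single k]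
  · rw [coeff_mode, Pi.single_eq_same]
  · intro l hl
    rw [coeff_mode, Pi.single_eq_of_ne hl, smul_zero]

theorem mode_zero_eq_constField (hr : 0 < r) (v : Vec d) :
    mode d j hr 0 v = constField j r v := by
  refine Subtype.ext (funext fun θ => ?_)
  by_cases hθ : θ ∈ strip d r
  · refine (mode_apply hr 0 v hθ).trans ?_
    rw [character_zero, one_smul]
    exact (Set.indicator_of_mem hθ fun _ => v).symm
  · exact ((mode d j hr 0 v).isField.zero_off θ hθ).trans
      ((constField j r v).isField.zero_off θ hθ).symm

/-! ### Bounded linear maps prescribed mode by mode, and completeness. -/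

section Lift

variable {E : Type*} [NormedAddCommGroup E] [NormedSpace ℂ E]

theorem summable_norm_lift {C : ℝ} {T : (Fin d → ℤ) → Vec d →L[ℂ] E}
    (hT : ∀ k, ‖T k‖ ≤ C * weight j r k) (f : FieldSpace d j r) :
    Summable fun k => ‖T k (coeff f k)‖ := by
  refine Summable.of_nonneg_of_le (fun _ => norm_nonneg _) (fun k => ?_)
    (f.isField.summable.mul_left C)
  rw [← mul_assoc]
  exact (T k).le_of_opNorm_le (hT k) _

variable [CompleteSpace E]

/-- The continuous linear map `f ↦ ∑ T_k f_k` defined by a family of linear maps that is bounded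
relative to the weights. -/
def lift (C : ℝ) (T : (Fin d → ℤ) → Vec d →L[ℂ] E) (hT : ∀ k, ‖T k‖ ≤ C * weight j r k) :
    FieldSpace d j r →L[ℂ] E :=
  LinearMap.mkContinuous
    { toFun := fun f => ∑' k, T k (coeff f k)
      map_add' := fun f g => by
        rw [← (summable_norm_lift hT f).of_norm.tsum_add (summable_norm_lift hT g).of_norm]
        simp only [FieldSpace.coeff_add, map_add]
      map_smul' := fun c f => by
        rw [RingHom.id_apply, ← tsum_const_smul'']
        exact tsum_congr fun k => by rw [← map_smul]; exact congrArg (T k) (coeff_smul c f k) }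
    C fun f => by
      rw [FieldSpace.norm_def, ← tsum_mul_left]
      refine tsum_of_norm_bounded (f.isField.summable.mul_left C).hasSum fun k => ?_
      rw [← mul_assoc]
      exact (T k).le_of_opNorm_le (hT k) _

variable {C : ℝ} {T : (Fin d → ℤ) → Vec d →L[ℂ] E}

theorem hasSum_lift (hT : ∀ k, ‖T k‖ ≤ C * weight j r k) (f : FieldSpace d j r) :
    HasSum (fun k => T k (coeff f k)) (lift C T hT f) :=
  (summable_norm_lift hT f).of_norm.hasSum

/-- In a weighted `ℓ₁` space a bound on single modes is a bound on the operator, without loss of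
constant. The bounds for the multiplication, Jacobian, phase, solution and projection operators are
obtained in this way. -/
theorem norm_lift_le (hC : 0 ≤ C) (hT : ∀ k, ‖T k‖ ≤ C * weight j r k) : ‖lift C T hT‖ ≤ C :=
  LinearMap.mkContinuous_norm_le _ hC _

theorem lift_mode (hr : 0 < r) (hT : ∀ k, ‖T k‖ ≤ C * weight j r k) (k : Fin d → ℤ) (v : Vec d) :
    lift C T hT (mode d j hr k v) = T k v := by
  refine (hasSum_lift hT _).unique ?_
  have : ∀ l, l ≠ k → T l (coeff (mode d j hr k v) l) = 0 := fun l hl => by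
    rw [coeff_mode, Pi.single_eq_of_ne hl, map_zero]
  convert! hasSum_single k this using 1
  rw [coeff_mode, Pi.single_eq_same]

end Lift

/-- The isometry of the space of fields with `ℓ₁`. -/
def toLp (d j : ℕ) (r : ℝ) : FieldSpace d j r →ₗᵢ[ℂ] lp (fun _ : Fin d → ℤ => Vec d) 1 where
  toFun f := ⟨fun k => (weight j r k : ℂ) • coeff f k, by
    refine memℓp_gen (f.isField.summable.congr fun k => ?_)
    simp [norm_smul, abs_of_pos (weight_pos j r k)]⟩
  map_add' f g := by
    ext1
    funext k
    change (weight j r k : ℂ) • coeff (f + g : FieldSpace d j r) k =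
      (weight j r k : ℂ) • coeff f k + (weight j r k : ℂ) • coeff g k
    rw [FieldSpace.coeff_add, smul_add]
  map_smul' c f := by
    ext1
    funext k
    change (weight j r k : ℂ) • coeff (c • f : FieldSpace d j r) k =
      c • (weight j r k : ℂ) • coeff f k
    rw [← coeffL_apply, map_smul, smul_comm, coeffL_apply]
  norm_map' f := by
    rw [lp.norm_eq_tsum_rpow (by simp), FieldSpace.norm_def]
    simp [norm_smul, abs_of_pos (weight_pos j r _)]

/-- Divide out the weight. Positivity of `r` matters: otherwise the strip is empty and the space of
fields is zero. -/
theorem surjective_toLp (hr : 0 < r) : Function.Surjective (toLp d j r) := by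
  intro a
  have hs := (lp.memℓp a).summable (by simp)
  have hw : ∀ k : Fin d → ℤ, weight j r k ≠ 0 := fun k => (weight_pos j r k).ne'
  refine ⟨ofCoeff hr (fun k => (weight j r k : ℂ)⁻¹ • a k) (hs.congr fun k => ?_), ?_⟩
  · simp [norm_smul, abs_of_pos (weight_pos j r k), mul_inv_cancel_left₀ (hw k)]
  · ext1
    funext k
    change (weight j r k : ℂ) • coeff _ k = _
    rw [coeff_ofCoeff, smul_inv_smul₀ (Complex.ofReal_ne_zero.mpr (hw k))]

theorem FieldSpace.completeSpace (hr : 0 < r) : CompleteSpace (FieldSpace d j r) :=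
  ((toLp d j r).isometry.isUniformInducing.completeSpace_congr (surjective_toLp hr)).mpr
    inferInstance

/-- The series converges absolutely, hence converges by completeness, and its limit is identified by
its coefficients. So the modes span a dense subspace. -/
theorem FieldSpace.hasSum_mode (hr : 0 < r) (f : FieldSpace d j r) :
    HasSum (fun k => mode d j hr k (coeff f k)) f := by
  have := FieldSpace.completeSpace (d := d) (j := j) hr
  have hs : Summable fun k => mode d j hr k (coeff f k) :=
    (summable_norm_lift (C := 1) (T := fun k => mode d j hr k)
      (fun k => by rw [one_mul]; exact norm_mode_le hr k) f).of_norm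
  convert! hs.hasSum using 1
  refine FieldSpace.ext_coeff fun l => ?_
  rw [← coeffL_apply l (∑' k, mode d j hr k (coeff f k)), (coeffL d j r l).map_tsum hs,
    tsum_eq_single l]
  · rw [coeffL_apply, coeff_mode, Pi.single_eq_same]
  · intro k hk
    rw [coeffL_apply, coeff_mode, Pi.single_eq_of_ne hk.symm]

/-- Continuous linear maps that agree on all modes are equal. -/
theorem FieldSpace.clm_ext {E : Type*} [NormedAddCommGroup E] [NormedSpace ℂ E] (hr : 0 < r)
    {S T : FieldSpace d j r →L[ℂ] E} (h : ∀ k v, S (mode d j hr k v) = T (mode d j hr k v)) :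
    S = T := by
  ext f
  refine ((f.hasSum_mode hr).mapL S).unique ?_
  simp only [h]
  exact (f.hasSum_mode hr).mapL T

end

end TorusField

/-! ### Power series, operator exponentials and Neumann inverses in Banach spaces. -/

section General

open NormedSpace (exp expSeries)

variable {E F : Type*} [NormedAddCommGroup E] [NormedSpace ℂ E] [NormedAddCommGroup F]
  [NormedSpace ℂ F]

/-- A normally convergent sum of power series is a power series. -/
theorem hasFPowerSeriesOnBall_tsum [CompleteSpace F] {ι : Type*} {f : ι → E → F}
    {p : ι → FormalMultilinearSeries ℂ E F} {R : NNReal} (hR : 0 < R)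
    (hp : Summable fun x : ι × ℕ => ‖p x.1 x.2‖ * (R : ℝ) ^ x.2)
    (hf : ∀ i y, HasSum (fun n => p i n fun _ => y) (f i y)) :
    HasFPowerSeriesOnBall (fun y => ∑' i, f i y) (fun n => ∑' i, p i n) 0 R := by
  have hn : ∀ n, Summable fun i => ‖p i n‖ := fun n =>
    (summable_mul_right_iff (a := (R : ℝ) ^ n) (by positivity)).mp (hp.prod_symm.prod_factor n)
  refine ⟨?_, by exact_mod_cast hR, ?_⟩
  · refine FormalMultilinearSeries.le_radius_of_summable _
      (Summable.of_nonneg_of_le (fun n => by positivity) (fun n => ?_) hp.prod_symm.prod)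
    simp only [Prod.fst_swap, Prod.snd_swap]
    rw [tsum_mul_right]
    exact mul_le_mul_of_nonneg_right (norm_tsum_le_tsum_norm (hn n)) (by positivity)
  · intro y hy
    rw [zero_add]
    have hy' : ‖y‖ ≤ R := by
      have : ‖y‖ < R := by simpa using hy
      exact this.le
    have hs : Summable fun x : ι × ℕ => p x.1 x.2 fun _ => y := by
      refine Summable.of_norm_bounded hp fun x => ?_
      refine ((p x.1 x.2).le_opNorm _).trans ?_
      simp only [Finset.prod_const, Finset.card_univ, Fintype.card_fin]
      gcongr
    -- The double series converges absolutely: summing over `n` first gives the functions, summing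
    -- over `i` first gives the new power series.
    have h1 := hs.hasSum.prod_fiberwise fun i => hf i y
    rw [h1.tsum_eq]
    rw [← (Equiv.prodComm ℕ ι).tsum_eq]
    exact hs.prod_symm.hasSum.prod_fiberwise fun n =>
      ContinuousMultilinearMap.hasSum_eval (hn n).of_norm.hasSum fun _ => y

/-- Induction on the dimension, splitting off one coordinate: the lattice sum factors into
one-dimensional sums. -/
theorem summable_prod_apply {g : ℤ → ℝ} (hg : Summable g) (h0 : ∀ n, 0 ≤ g n) :
    ∀ d : ℕ, Summable fun k : Fin d → ℤ => ∏ i, g (k i)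
  | 0 => (hasSum_fintype _).summable
  | d + 1 => by
    have ih := summable_prod_apply hg h0 d
    have h := hg.mul_of_nonneg ih h0 fun k => Finset.prod_nonneg fun i _ => h0 _
    rw [← (Fin.consEquiv fun _ : Fin (d + 1) => ℤ).summable_iff]
    refine h.congr fun x => ?_
    simp [Fin.prod_univ_succ]

theorem norm_expSeries_le (n : ℕ) : ‖expSeries ℂ (E →L[ℂ] E) n‖ ≤ ((n.factorial : ℝ))⁻¹ := by
  have h : ‖ContinuousMultilinearMap.mkPiAlgebraFin ℂ n (E →L[ℂ] E)‖ ≤ 1 := by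
    -- For `n = 0` the value is the identity, of norm at most `1`, but of norm `0` when the space is
    -- trivial.
    rcases Nat.eq_zero_or_pos n with rfl | hn
    · rw [ContinuousMultilinearMap.norm_mkPiAlgebraFin_zero]
      exact ContinuousLinearMap.norm_id_le
    · exact ContinuousMultilinearMap.norm_mkPiAlgebraFin_le_of_pos hn
  refine (ContinuousMultilinearMap.opNorm_smul_le ((n.factorial : ℂ)⁻¹) _).trans ?_
  simpa using mul_le_mul_of_nonneg_left h (by positivity : (0 : ℝ) ≤ (n.factorial : ℝ)⁻¹)

theorem hasSum_expSeries_norm (x : ℝ) :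
    HasSum (fun n : ℕ => ((n.factorial : ℝ))⁻¹ * x ^ n) (Real.exp x) := by
  rw [Real.exp_eq_exp_ℝ]
  exact NormedSpace.exp_series_hasSum_exp' (𝕂 := ℝ) x

theorem norm_exp_clm_le [CompleteSpace E] (S : E →L[ℂ] E) : ‖exp S‖ ≤ Real.exp ‖S‖ := by
  rw [← (NormedSpace.expSeries_hasSum_exp (𝕂 := ℂ) S).tsum_eq]
  refine tsum_of_norm_bounded (hasSum_expSeries_norm ‖S‖) fun n => ?_
  refine ((expSeries ℂ (E →L[ℂ] E) n).le_opNorm _).trans ?_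
  simp only [Finset.prod_const, Finset.card_univ, Fintype.card_fin]
  gcongr
  exact norm_expSeries_le n

/-- A functional that intertwines `S` with a scalar `c` intertwines `exp S` with `exp c`. -/
theorem apply_exp_of_apply_eq_smul [CompleteSpace E] {S : E →L[ℂ] E} {L : E →L[ℂ] F} {c : ℂ}
    (h : ∀ g, L (S g) = c • L g) (g : E) : L (exp S g) = Complex.exp c • L g := by
  have h1 : ∀ n : ℕ, L ((S ^ n) g) = c ^ n • L g := by
    intro n
    induction n with
    | zero => simp
    | succ n ih => rw [pow_succ', mul_apply_eq_comp, h, ih, smul_smul, pow_succ']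
  have h2 := ((NormedSpace.exp_series_hasSum_exp' (𝕂 := ℂ) S).mapL
    (ContinuousLinearMap.apply ℂ E g)).mapL L
  have h3 := (NormedSpace.exp_series_hasSum_exp' (𝕂 := ℂ) c).smul_const (L g)
  rw [← Complex.exp_eq_exp_ℂ] at h3
  refine h2.unique (h3.congr_fun fun n => ?_)
  rw [map_smul, map_smul, ContinuousLinearMap.apply_apply, h1, smul_smul, smul_eq_mul]

theorem isUnit_one_add_of_norm_lt_one [CompleteSpace E] {S : E →L[ℂ] E} (hS : ‖S‖ < 1) :
    IsUnit (1 + S) := by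
  simpa using isUnit_one_sub_of_norm_lt_one (x := -S) (by simpa using hS)

/-- If `y = (1 + S)⁻¹ g`, then `y = g - S y`, whence `(1 - ‖S‖) ‖y‖ ≤ ‖g‖`. The argument remains
valid on a trivial space, where `‖1‖ = 0`. -/
theorem norm_inverse_one_add_le [CompleteSpace E] {S : E →L[ℂ] E} (hS : ‖S‖ < 1) :
    ‖Ring.inverse (1 + S)‖ ≤ (1 - ‖S‖)⁻¹ := by
  have hu := isUnit_one_add_of_norm_lt_one hS
  have h1 : 0 < 1 - ‖S‖ := sub_pos.mpr hS
  refine ContinuousLinearMap.opNorm_le_bound _ (inv_nonneg.mpr h1.le) fun g => ?_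
  have h2 : (1 + S) (Ring.inverse (1 + S) g) = g := by
    rw [← mul_apply_eq_comp, Ring.mul_inverse_cancel _ hu,
      one_apply_eq_self]
  set y := Ring.inverse (1 + S) g
  have h3 : ‖y‖ ≤ ‖g‖ + ‖S‖ * ‖y‖ := by
    have : y = g - S y := by
      rw [← h2]
      simp
    calc ‖y‖ = ‖g - S y‖ := by rw [← this]
      _ ≤ ‖g‖ + ‖S y‖ := norm_sub_le _ _
      _ ≤ _ := by gcongr; exact S.le_opNorm y
  rw [inv_mul_eq_div, le_div_iff₀ h1]
  linarith

end General

/-! ### Multiplication, Jacobian, homological equation and Fourier projections. -/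

namespace TorusField

noncomputable section

open NormedSpace (exp expSeries)

variable {d : ℕ} {s : ℝ} [hs : Fact (0 < s)]

instance (d j : ℕ) (s : ℝ) [hs : Fact (0 < s)] : CompleteSpace (FieldSpace d j s) :=
  FieldSpace.completeSpace hs.out

theorem weight_zero (r : ℝ) (k : Fin d → ℤ) : weight 0 r k = Real.exp (r * freqNorm k) := by
  simp [weight]

/-- Submultiplicativity of the weights makes multiplication by a matrix-valued mode bounded on
`𝒜_d(s)`. -/
theorem weight_add_le (k l : Fin d → ℤ) : weight 0 s (k + l) ≤ weight 0 s k * weight 0 s l := by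
  rw [weight_zero, weight_zero, weight_zero, ← Real.exp_add, ← mul_add]
  exact Real.exp_le_exp.mpr (mul_le_mul_of_nonneg_left (freqNorm_add_le k l) hs.out.le)

theorem FieldSpace.ext_strip {j : ℕ} {r : ℝ} {f g : FieldSpace d j r}
    (h : ∀ θ ∈ strip d r, f θ = g θ) : f = g := by
  refine Subtype.ext (funext fun θ => ?_)
  by_cases hθ : θ ∈ strip d r
  · exact h θ hθ
  · exact (f.isField.zero_off θ hθ).trans (g.isField.zero_off θ hθ).symm

@[simp] theorem FieldSpace.coe_zero {j : ℕ} {r : ℝ} : ((0 : FieldSpace d j r) : Vec d → Vec d) = 0 :=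
  rfl

theorem norm_mode_comp_le (B : Vec d →L[ℂ] Vec d) (k l : Fin d → ℤ) :
    ‖(mode d 0 hs.out (k + l)).comp B‖ ≤ (weight 0 s k * ‖B‖) * weight 0 s l := by
  refine (ContinuousLinearMap.opNorm_comp_le _ _).trans ?_
  calc _ ≤ (weight 0 s k * weight 0 s l) * ‖B‖ :=
        mul_le_mul_of_nonneg_right ((norm_mode_le hs.out _).trans (weight_add_le k l))
          (norm_nonneg _)
    _ = _ := by ring

/-- The multiplication by the matrix-valued function `B e^{2πi k·θ}`. -/
def mulOp (d : ℕ) (s : ℝ) [hs : Fact (0 < s)] (k : Fin d → ℤ) :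
    (Vec d →L[ℂ] Vec d) →L[ℂ] (A d s →L[ℂ] A d s) :=
  LinearMap.mkContinuous
    { toFun := fun B => lift (weight 0 s k * ‖B‖) (fun l => (mode d 0 hs.out (k + l)).comp B)
        (norm_mode_comp_le B k)
      map_add' := fun B B' => FieldSpace.clm_ext hs.out fun l v => by
        rw [add_apply, lift_mode, lift_mode, lift_mode]
        simp
      map_smul' := fun c B => FieldSpace.clm_ext hs.out fun l v => by
        rw [RingHom.id_apply, smul_apply, lift_mode, lift_mode]
        simp }
    (weight 0 s k) fun B =>
      norm_lift_le (mul_nonneg (weight_pos 0 s k).le (norm_nonneg _)) (norm_mode_comp_le B k)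

theorem norm_mulOp_le (k : Fin d → ℤ) : ‖mulOp d s k‖ ≤ weight 0 s k :=
  LinearMap.mkContinuous_norm_le _ (weight_pos 0 s k).le _

theorem mulOp_mode (k l : Fin d → ℤ) (B : Vec d →L[ℂ] Vec d) (v : Vec d) :
    mulOp d s k B (mode d 0 hs.out l v) = mode d 0 hs.out (k + l) (B v) :=
  lift_mode hs.out (norm_mode_comp_le B k) l v

theorem mulOp_apply (k : Fin d → ℤ) (B : Vec d →L[ℂ] Vec d) (g : A d s) {θ : Vec d}
    (hθ : θ ∈ strip d s) : mulOp d s k B g θ = character k θ • B (g θ) := by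
  have : (evalL 0 hs.out hθ).comp (mulOp d s k B) =
      (character k θ • B).comp (evalL 0 hs.out hθ) := by
    refine FieldSpace.clm_ext hs.out fun l v => ?_
    simp only [ContinuousLinearMap.comp_apply, mulOp_mode, evalL_apply, mode_apply hs.out _ _ hθ,
      smul_apply, map_smul, smul_smul, character_add,
      mul_comm]
  exact congrArg (fun T => T g) this

/-- The functional `v ↦ 2πi (k·v)`. -/
def freqL (k : Fin d → ℤ) : Vec d →L[ℂ] ℂ := (2 * Real.pi * Complex.I : ℂ) • dotL k

theorem freqL_apply (k : Fin d → ℤ) (v : Vec d) :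
    freqL k v = 2 * Real.pi * Complex.I * dot v k := rfl

theorem norm_freqL_le (k : Fin d → ℤ) : ‖freqL k‖ ≤ 2 * Real.pi * freqNorm k := by
  rw [freqL, norm_smul]
  have : ‖(2 * Real.pi * Complex.I : ℂ)‖ = 2 * Real.pi := by simp [abs_of_pos Real.pi_pos]
  rw [this]
  exact mul_le_mul_of_nonneg_left (norm_dotL_le k) (by positivity)

/-- Differentiating the `k`-th mode costs `2π‖k‖`, which the extra factor `1 + 2π‖k‖` of the primed
norm pays for. -/
theorem norm_jacobianOp_aux (k : Fin d → ℤ) :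
    ‖(mulOp d s k).comp (ContinuousLinearMap.smulRightL ℂ (Vec d) (Vec d) (freqL k))‖ ≤
      1 * weight 1 s k := by
  refine (ContinuousLinearMap.opNorm_comp_le _ _).trans ?_
  have h1 : ‖ContinuousLinearMap.smulRightL ℂ (Vec d) (Vec d) (freqL k)‖ ≤
      2 * Real.pi * freqNorm k := by
    refine ContinuousLinearMap.opNorm_le_bound _ ?_ fun v => ?_
    · have := freqNorm_nonneg k
      positivity
    · change ‖(freqL k).smulRight v‖ ≤ _
      rw [ContinuousLinearMap.norm_smulRight_apply]
      exact mul_le_mul_of_nonneg_right (norm_freqL_le k) (norm_nonneg _)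
  calc _ ≤ weight 0 s k * (2 * Real.pi * freqNorm k) :=
        mul_le_mul (norm_mulOp_le k) h1 (norm_nonneg _) (weight_pos _ _ _).le
    _ ≤ weight 0 s k * (1 + 2 * Real.pi * freqNorm k) :=
        mul_le_mul_of_nonneg_left (by linarith) (weight_pos _ _ _).le
    _ = _ := by
        simp only [weight, pow_zero, pow_one]
        ring

/-- The operator `g ↦ (Du) g`, as a function of `u`. -/
def jacobianOp (d : ℕ) (s : ℝ) [Fact (0 < s)] : A' d s →L[ℂ] (A d s →L[ℂ] A d s) :=
  lift 1 (fun k => (mulOp d s k).comp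
    (ContinuousLinearMap.smulRightL ℂ (Vec d) (Vec d) (freqL k))) norm_jacobianOp_aux

theorem norm_jacobianOp_apply_le (u : A' d s) : ‖jacobianOp d s u‖ ≤ ‖u‖ := by
  simpa using (jacobianOp d s).le_of_opNorm_le
    (norm_lift_le zero_le_one norm_jacobianOp_aux) u

theorem jacobianOp_mode (k : Fin d → ℤ) (v c : Vec d) :
    jacobianOp d s (mode d 1 hs.out k v) (mode d 0 hs.out 0 c) =
      mode d 0 hs.out k (freqL k c • v) := by
  rw [jacobianOp, lift_mode, ContinuousLinearMap.comp_apply, mulOp_mode, add_zero]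
  rfl

theorem jacobianOp_apply (u : A' d s) (g : A d s) {θ : Vec d} (hθ : θ ∈ strip d s) :
    jacobianOp d s u g θ = fderiv ℂ u θ (g θ) := by
  have hb : ∀ k, ‖ContinuousLinearMap.smulRightL ℂ (Vec d) (Vec d)
      (character k θ • freqL k)‖ ≤ 1 * weight 1 s k := by
    intro k
    refine ContinuousLinearMap.opNorm_le_bound _ (by rw [one_mul]; exact (weight_pos _ _ _).le)
      fun v => ?_
    change ‖(character k θ • freqL k).smulRight v‖ ≤ _
    rw [ContinuousLinearMap.norm_smulRight_apply, norm_smul]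
    refine mul_le_mul_of_nonneg_right ?_ (norm_nonneg _)
    calc _ ≤ Real.exp (s * freqNorm k) * (2 * Real.pi * freqNorm k) :=
          mul_le_mul (norm_character_le_of_mem hθ k) (norm_freqL_le k) (norm_nonneg _)
            (Real.exp_nonneg _)
      _ ≤ Real.exp (s * freqNorm k) * (1 + 2 * Real.pi * freqNorm k) :=
          mul_le_mul_of_nonneg_left (by linarith) (Real.exp_nonneg _)
      _ = _ := by
          simp only [weight, pow_one]
          ring
  have h1 := (hasSum_lift hb u).mapL (ContinuousLinearMap.apply ℂ (Vec d) (g θ))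
  have h2 : fderiv ℂ u θ = lift 1 _ hb u := by
    rw [(u.hasFDerivAt hs.out hθ).fderiv, ← (hasSum_lift hb u).tsum_eq]
    refine tsum_congr fun k => ?_
    rw [mul_comm, ← smul_smul]
    rfl
  have h3 := ((hasSum_lift norm_jacobianOp_aux u).mapL
    (ContinuousLinearMap.apply ℂ (A d s) g)).mapL (evalL 0 hs.out hθ)
  rw [h2]
  refine h3.unique (h1.congr_fun fun k => ?_)
  change mulOp d s k _ g θ = _
  rw [mulOp_apply _ _ _ hθ]
  simp [smul_smul]

theorem norm_phaseOp_aux (j : ℕ) (k l : Fin d → ℤ) :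
    ‖(mulOp d s l).comp ((freqL k).smulRight (ContinuousLinearMap.id ℂ (Vec d)))‖ ≤
      (2 * Real.pi * freqNorm k) * weight j s l := by
  refine (ContinuousLinearMap.opNorm_comp_le _ _).trans ?_
  rw [ContinuousLinearMap.norm_smulRight_apply, mul_comm]
  refine mul_le_mul ?_ ((norm_mulOp_le l).trans ?_) (norm_nonneg _) ?_
  · exact (mul_le_of_le_one_right (norm_nonneg _) ContinuousLinearMap.norm_id_le).trans
      (norm_freqL_le k)
  · rw [weight_zero]
    exact exp_le_weight j s l
  · have := freqNorm_nonneg k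
    positivity

/-- The multiplication by the scalar function `2πi k·u`, as a function of `u`. -/
def phaseOp (d : ℕ) (s : ℝ) [Fact (0 < s)] (k : Fin d → ℤ) :
    A' d s →L[ℂ] (A d s →L[ℂ] A d s) :=
  lift (2 * Real.pi * freqNorm k)
    (fun l => (mulOp d s l).comp ((freqL k).smulRight (ContinuousLinearMap.id ℂ (Vec d))))
    (norm_phaseOp_aux 1 k)

theorem norm_phaseOp_le (k : Fin d → ℤ) : ‖phaseOp d s k‖ ≤ 2 * Real.pi * freqNorm k :=
  norm_lift_le (by have := freqNorm_nonneg k; positivity) (norm_phaseOp_aux 1 k)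

theorem phaseOp_apply (k : Fin d → ℤ) (u : A' d s) (g : A d s) {θ : Vec d}
    (hθ : θ ∈ strip d s) : phaseOp d s k u g θ = freqL k (u θ) • g θ := by
  have h1 := ((hasSum_lift (norm_phaseOp_aux 1 k) u).mapL
    (ContinuousLinearMap.apply ℂ (A d s) g)).mapL (evalL 0 hs.out hθ)
  have h2 := ((u.hasSum_apply hs.out hθ).mapL (freqL k)).smul_const (g θ)
  refine h1.unique (h2.congr_fun fun l => ?_)
  change mulOp d s l _ g θ = _
  rw [mulOp_apply _ _ _ hθ]
  simp [smul_smul]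

/-- The small divisor estimate. A far `k` is nonzero, so `‖k‖ ≥ 1` and `1 + 2π‖k‖ ≤ 4π‖k‖`, while
the divisor exceeds `2πσ‖k‖`; the quotient is at most `2/σ`, even with the primed norm on the
solution. -/
theorem norm_solveOp_aux {σ : ℝ} (hσ : 0 < σ) (ω : Vec d) (k : Fin d → ℤ) :
    ‖(farIndices σ ω).indicator (fun k => (freqL k ω)⁻¹ • mode d 1 hs.out k) k‖ ≤
      2 / σ * weight 0 s k := by
  by_cases hk : k ∈ farIndices σ ω
  swap
  · rw [Set.indicator_of_notMem hk, norm_zero]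
    exact mul_nonneg (by positivity) (weight_pos _ _ _).le
  rw [Set.indicator_of_mem hk, norm_smul, norm_inv, freqL_apply]
  have hk' : σ * freqNorm k < ‖dot ω k‖ := hk
  have hk0 : k ≠ 0 := by
    rintro rfl
    rw [dot_zero_right, norm_zero] at hk'
    exact absurd hk' (not_lt.mpr (mul_nonneg hσ.le (freqNorm_nonneg _)))
  have h1 := one_le_freqNorm hk0
  have hπ := Real.pi_gt_three
  have h2 : ‖(2 * Real.pi * Complex.I * dot ω k : ℂ)‖ = 2 * Real.pi * ‖dot ω k‖ := by
    simp [abs_of_pos Real.pi_pos]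
  rw [h2]
  have h3 : 0 < σ * freqNorm k := by positivity
  have h4 : (1 + 2 * Real.pi * freqNorm k) ≤ 2 / σ * (2 * Real.pi * ‖dot ω k‖) := by
    have h5 : freqNorm k ≤ ‖dot ω k‖ / σ := by
      rw [le_div_iff₀ hσ]
      linarith
    have h6 : 2 / σ * (2 * Real.pi * ‖dot ω k‖) = 4 * Real.pi * (‖dot ω k‖ / σ) := by ring
    rw [h6]
    nlinarith
  have h7 : 0 < 2 * Real.pi * ‖dot ω k‖ := by
    have := h3.trans hk'
    positivity
  rw [inv_mul_eq_div, div_le_iff₀ h7]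
  calc ‖mode d 1 hs.out k‖ ≤ weight 1 s k := norm_mode_le hs.out k
    _ = (1 + 2 * Real.pi * freqNorm k) * weight 0 s k := by simp [weight]
    _ ≤ 2 / σ * (2 * Real.pi * ‖dot ω k‖) * weight 0 s k :=
        mul_le_mul_of_nonneg_right h4 (weight_pos _ _ _).le
    _ = _ := by ring

/-- The solution operator of `(Du) ω = g` for `g` with far from resonance terms only; the resonant
terms of `g` are dropped. -/
def solveOp (s : ℝ) [hs : Fact (0 < s)] {σ : ℝ} (hσ : 0 < σ) (ω : Vec d) : A d s →L[ℂ] A' d s :=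
  lift (2 / σ) ((farIndices σ ω).indicator fun k => (freqL k ω)⁻¹ • mode d 1 hs.out k)
    (norm_solveOp_aux hσ ω)

theorem norm_solveOp_apply_le {σ : ℝ} (hσ : 0 < σ) (ω : Vec d) (g : A d s) :
    ‖solveOp s hσ ω g‖ ≤ 2 / σ * ‖g‖ :=
  (solveOp s hσ ω).le_of_opNorm_le (norm_lift_le (by positivity) (norm_solveOp_aux hσ ω)) g

theorem norm_projOp_aux {r : ℝ} (hsr : s ≤ r) (j : ℕ) (I : Set (Fin d → ℤ)) (k : Fin d → ℤ) :
    ‖I.indicator (mode d 0 hs.out) k‖ ≤ 1 * weight j r k := by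
  rw [one_mul]
  by_cases hk : k ∈ I
  · rw [Set.indicator_of_mem hk]
    refine (norm_mode_le hs.out k).trans (le_trans ?_ (exp_le_weight j r k))
    rw [weight_zero]
    exact Real.exp_le_exp.mpr (mul_le_mul_of_nonneg_right hsr (freqNorm_nonneg k))
  · rw [Set.indicator_of_notMem hk, norm_zero]
    exact (weight_pos _ _ _).le

/-- The Fourier projection, followed by the restriction to a smaller strip. -/
def projOp {r : ℝ} (hsr : s ≤ r) (j : ℕ) (I : Set (Fin d → ℤ)) : FieldSpace d j r →L[ℂ] A d s :=
  lift 1 (I.indicator (mode d 0 hs.out)) (norm_projOp_aux hsr j I)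

theorem projOp_mode {r : ℝ} (hsr : s ≤ r) (j : ℕ) (I : Set (Fin d → ℤ)) (k : Fin d → ℤ)
    (v : Vec d) : projOp hsr j I (mode d j (hs.out.trans_le hsr) k v) =
      I.indicator (fun k => mode d 0 hs.out k v) k := by
  rw [projOp, lift_mode]
  by_cases hk : k ∈ I <;> simp [hk]

theorem norm_projOp_apply_le {r : ℝ} (hsr : s ≤ r) (j : ℕ) (I : Set (Fin d → ℤ))
    (f : FieldSpace d j r) : ‖projOp hsr j I f‖ ≤ ‖f‖ := by
  simpa using (projOp hsr j I).le_of_opNorm_le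
    (norm_lift_le zero_le_one (norm_projOp_aux hsr j I)) f

theorem projOp_apply {r : ℝ} (hsr : s ≤ r) (j : ℕ) (I : Set (Fin d → ℤ))
    (f : FieldSpace d j r) {θ : Vec d} (hθ : θ ∈ strip d s) :
    projOp hsr j I f θ = fourierProj I f θ := by
  have h1 := (hasSum_lift (norm_projOp_aux hsr j I) f).mapL (evalL 0 hs.out hθ)
  refine h1.tsum_eq.symm.trans ?_
  rw [fourierProj, tsum_subtype I fun k => character k θ • coeff f k]
  refine tsum_congr fun k => ?_
  by_cases hk : k ∈ I
  · simp [hk, mode_apply hs.out _ _ hθ]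
  · rw [Set.indicator_of_notMem hk, Set.indicator_of_notMem hk]
    simp

theorem coeff_projOp {r : ℝ} (hsr : s ≤ r) (j : ℕ) (I : Set (Fin d → ℤ))
    (f : FieldSpace d j r) (k : Fin d → ℤ) :
    coeff (projOp hsr j I f) k = I.indicator (fun k => coeff f k) k := by
  have : (coeffL d 0 s k).comp (projOp hsr j I) =
      I.indicator (fun k => coeffL d j r k) k := by
    refine FieldSpace.clm_ext (hs.out.trans_le hsr) fun l v => ?_
    rw [ContinuousLinearMap.comp_apply, projOp_mode]
    by_cases hl : l ∈ I <;> by_cases hk : k ∈ I <;> by_cases hkl : k = l <;>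
      simp_all [coeff_mode, coeff_zero]
  have h := congrArg (fun T => T f) this
  refine h.trans ?_
  by_cases hk : k ∈ I <;> simp [hk]

/-- `solveOp` solves the homological equation. -/
theorem jacobianOp_solveOp {σ : ℝ} (hσ : 0 < σ) (ω : Vec d) (g : A d s) :
    jacobianOp d s (solveOp s hσ ω g) (mode d 0 hs.out 0 ω) =
      projOp le_rfl 0 (farIndices σ ω) g := by
  have : ((ContinuousLinearMap.apply ℂ (A d s) (mode d 0 hs.out 0 ω)).comp
      (jacobianOp d s)).comp (solveOp s hσ ω) = projOp le_rfl 0 (farIndices σ ω) := by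
    refine FieldSpace.clm_ext hs.out fun k v => ?_
    rw [projOp_mode, ContinuousLinearMap.comp_apply, ContinuousLinearMap.comp_apply,
      ContinuousLinearMap.apply_apply, solveOp, lift_mode]
    by_cases hk : k ∈ farIndices σ ω
    · rw [Set.indicator_of_mem hk, Set.indicator_of_mem hk, smul_apply,
        ← map_smul, jacobianOp_mode, smul_smul, mul_inv_cancel₀, one_smul]
      have hk' : σ * freqNorm k < ‖dot ω k‖ := hk
      have h0 : dot ω k ≠ 0 := norm_pos_iff.mp
        ((mul_nonneg hσ.le (freqNorm_nonneg k)).trans_lt hk')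
      rw [freqL_apply]
      simp [h0, Real.pi_ne_zero]
    · rw [Set.indicator_of_notMem hk, Set.indicator_of_notMem hk]
      simp
  exact congrArg (fun T => T g) this

/-- The derivative of a field without resonant terms in a constant direction has no resonant
terms. -/
theorem projOp_jacobianOp_solveOp {σ : ℝ} (hσ : 0 < σ) (ω c : Vec d) (g : A d s) :
    projOp le_rfl 0 (resonantIndices σ ω)
      (jacobianOp d s (solveOp s hσ ω g) (mode d 0 hs.out 0 c)) = 0 := by
  have : (projOp le_rfl 0 (resonantIndices σ ω)).comp
      (((ContinuousLinearMap.apply ℂ (A d s) (mode d 0 hs.out 0 c)).comp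
      (jacobianOp d s)).comp (solveOp s hσ ω)) = 0 := by
    refine FieldSpace.clm_ext hs.out fun k v => ?_
    rw [ContinuousLinearMap.comp_apply, ContinuousLinearMap.comp_apply,
      ContinuousLinearMap.comp_apply,
      ContinuousLinearMap.apply_apply, solveOp, lift_mode]
    by_cases hk : k ∈ farIndices σ ω
    -- Differentiation in a constant direction preserves the frequency, so a far mode stays far.
    · rw [Set.indicator_of_mem hk, smul_apply,
        ← map_smul, jacobianOp_mode, projOp_mode, Set.indicator_of_notMem (by simpa
          [resonantIndices] using hk)]
      rfl
    · rw [Set.indicator_of_notMem hk]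
      simp
  exact congrArg (fun T => T g) this

end

end TorusField

/-! ### Composition with `id + u` as an analytic function of `u`. -/

namespace TorusField

noncomputable section

open NormedSpace (exp expSeries)

variable {d : ℕ} {s : ℝ} [hs : Fact (0 < s)] {r : ℝ}

theorem summable_exp_neg_freqNorm (d : ℕ) {c : ℝ} (hc : 0 < c) :
    Summable fun k : Fin d → ℤ => Real.exp (-(c * freqNorm k)) := by
  have hn : Summable fun n : ℕ => Real.exp (-(c * n)) := by
    have := Real.summable_exp_nat_mul_iff.mpr (neg_lt_zero.mpr hc)
    refine this.congr fun n => ?_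
    ring_nf
  have h : Summable fun n : ℤ => Real.exp (-(c * |(n : ℝ)|)) := by
    refine Summable.of_nat_of_neg ?_ ?_ <;> simpa using hn
  refine (summable_prod_apply h (fun _ => Real.exp_nonneg _) d).congr fun k => ?_
  rw [← Real.exp_sum, freqNorm, Finset.mul_sum, Finset.sum_neg_distrib]

/-- The map `S ↦ (f ↦ S (f_k e^{2πi k·θ}))`. -/
def modeTerm (d : ℕ) (s : ℝ) [hs : Fact (0 < s)] (r : ℝ) (k : Fin d → ℤ) :
    (A d s →L[ℂ] A d s) →L[ℂ] (A' d r →L[ℂ] A d s) :=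
  (ContinuousLinearMap.compL ℂ (A' d r) (A d s) (A d s)).flip
    ((mode d 0 hs.out k).comp (coeffL d 1 r k))

theorem modeTerm_apply (k : Fin d → ℤ) (S : A d s →L[ℂ] A d s) (f : A' d r) :
    modeTerm d s r k S f = S (mode d 0 hs.out k (coeff f k)) := rfl

/-- The factor gained in passing from weight `r` to weight `s` is the reserve from which the
exponential of the phase is paid. -/
theorem norm_modeTerm_le (k : Fin d → ℤ) :
    ‖modeTerm d s r k‖ ≤ Real.exp (-((r - s) * freqNorm k)) := by
  refine ContinuousLinearMap.opNorm_le_bound _ (Real.exp_nonneg _) fun S => ?_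
  refine ContinuousLinearMap.opNorm_le_bound _ (by positivity) fun f => ?_
  rw [modeTerm_apply]
  have h1 : ‖mode d 0 hs.out k (coeff f k)‖ ≤ Real.exp (-((r - s) * freqNorm k)) * ‖f‖ := by
    calc _ ≤ weight 0 s k * ‖coeff f k‖ :=
          (mode d 0 hs.out k).le_of_opNorm_le (norm_mode_le hs.out k) _
      _ = Real.exp (-((r - s) * freqNorm k)) * (Real.exp (r * freqNorm k) * ‖coeff f k‖) := by
          rw [weight_zero, ← mul_assoc, ← Real.exp_add]
          ring_nf
      _ ≤ _ := by
          refine mul_le_mul_of_nonneg_left (le_trans ?_ (weight_mul_norm_coeff_le f k))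
            (Real.exp_nonneg _)
          exact mul_le_mul_of_nonneg_right (exp_le_weight 1 r k) (norm_nonneg _)
  calc _ ≤ ‖S‖ * (Real.exp (-((r - s) * freqNorm k)) * ‖f‖) :=
        (S.le_opNorm _).trans (mul_le_mul_of_nonneg_left h1 (norm_nonneg _))
    _ = _ := by ring

/-- The operator `f ↦ f ∘ (id + u)`. -/
def compOp (d : ℕ) (s : ℝ) [Fact (0 < s)] (r : ℝ) (u : A' d s) : A' d r →L[ℂ] A d s :=
  ∑' k, modeTerm d s r k (exp (phaseOp d s k u))

/-- The power series of one term of `compOp`. -/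
def compSeries (d : ℕ) (s : ℝ) [Fact (0 < s)] (r : ℝ) (k : Fin d → ℤ) :
    FormalMultilinearSeries ℂ (A' d s) (A' d r →L[ℂ] A d s) :=
  (modeTerm d s r k).compFormalMultilinearSeries
    ((expSeries ℂ (A d s →L[ℂ] A d s)).compContinuousLinearMap (phaseOp d s k))

theorem hasSum_compSeries (k : Fin d → ℤ) (u : A' d s) :
    HasSum (fun n => compSeries d s r k n fun _ => u)
      (modeTerm d s r k (exp (phaseOp d s k u))) :=
  (NormedSpace.expSeries_hasSum_exp (𝕂 := ℂ) (phaseOp d s k u)).mapL (modeTerm d s r k)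

theorem norm_compSeries_le (k : Fin d → ℤ) (n : ℕ) :
    ‖compSeries d s r k n‖ ≤ Real.exp (-((r - s) * freqNorm k)) *
      ((n.factorial : ℝ)⁻¹ * (2 * Real.pi * freqNorm k) ^ n) := by
  refine (ContinuousLinearMap.norm_compContinuousMultilinearMap_le _ _).trans ?_
  refine mul_le_mul (norm_modeTerm_le k) ?_ (norm_nonneg _) (Real.exp_nonneg _)
  refine (ContinuousMultilinearMap.norm_compContinuousLinearMap_le _ _).trans ?_
  simp only [Finset.prod_const, Finset.card_univ, Fintype.card_fin]
  have := norm_phaseOp_le (d := d) (s := s) k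
  exact mul_le_mul (norm_expSeries_le n) (by gcongr) (by positivity) (by positivity)

/-- `u ↦ (f ↦ f ∘ (id + u))` is given by a power series for small `u`. -/
theorem hasFPowerSeriesOnBall_compOp (hsr : s < r) :
    HasFPowerSeriesOnBall (compOp d s r) (fun n => ∑' k, compSeries d s r k n) 0
      ((r - s) / (4 * Real.pi)).toNNReal := by
  have hR : 0 < (r - s) / (4 * Real.pi) := div_pos (sub_pos.mpr hsr) (by positivity)
  refine hasFPowerSeriesOnBall_tsum (Real.toNNReal_pos.mpr hR) ?_ hasSum_compSeries
  rw [Real.coe_toNNReal _ hR.le]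
  -- With this radius `2π‖k‖R = (r - s)‖k‖/2`, so the phase uses half of the reserve and
  -- `e^{-(r-s)‖k‖/2}` is left for the sum over `k`.
  set R := (r - s) / (4 * Real.pi) with hRdef
  have hsum : ∀ k : Fin d → ℤ, HasSum (fun n : ℕ => Real.exp (-((r - s) * freqNorm k)) *
      ((n.factorial : ℝ)⁻¹ * (2 * Real.pi * freqNorm k * R) ^ n))
      (Real.exp (-((r - s) / 2 * freqNorm k))) := by
    intro k
    convert! (hasSum_expSeries_norm (2 * Real.pi * freqNorm k * R)).mul_left
      (Real.exp (-((r - s) * freqNorm k))) using 1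
    rw [← Real.exp_add, hRdef]
    congr 1
    field_simp
    ring
  have hs2 : Summable fun x : (Fin d → ℤ) × ℕ => Real.exp (-((r - s) * freqNorm x.1)) *
      ((x.2.factorial : ℝ)⁻¹ * (2 * Real.pi * freqNorm x.1 * R) ^ x.2) := by
    rw [summable_prod_of_nonneg]
    · refine ⟨fun k => (hsum k).summable, ?_⟩
      simp only [(hsum _).tsum_eq]
      exact summable_exp_neg_freqNorm d (half_pos (sub_pos.mpr hsr))
    · intro x
      have := freqNorm_nonneg x.1
      simp only [Pi.zero_apply]
      positivity
  refine Summable.of_nonneg_of_le (fun x => by positivity) (fun x => ?_) hs2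
  rw [mul_pow, ← mul_assoc (x.2.factorial : ℝ)⁻¹, ← mul_assoc (Real.exp _)]
  exact mul_le_mul_of_nonneg_right (norm_compSeries_le x.1 x.2) (by positivity)

theorem analyticOnNhd_compOp (hsr : s < r) :
    AnalyticOnNhd ℂ (compOp d s r) (Metric.ball 0 ((r - s) / (4 * Real.pi))) := by
  have := (hasFPowerSeriesOnBall_compOp (d := d) hsr).analyticOnNhd
  intro u hu
  refine this u ?_
  have hR : 0 < (r - s) / (4 * Real.pi) := div_pos (sub_pos.mpr hsr) (by positivity)
  rw [Metric.mem_eball, ← ENNReal.ofReal, edist_dist]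
  exact (ENNReal.ofReal_lt_ofReal_iff hR).mpr hu

theorem norm_exp_phaseOp_le {u : A' d s}
    (hu : ‖u‖ ≤ (r - s) / (4 * Real.pi)) (k : Fin d → ℤ) :
    ‖exp (phaseOp d s k u)‖ ≤ Real.exp ((r - s) / 2 * freqNorm k) := by
  refine (norm_exp_clm_le _).trans (Real.exp_le_exp.mpr ?_)
  refine ((phaseOp d s k).le_of_opNorm_le (norm_phaseOp_le k) u).trans ?_
  have h0 := freqNorm_nonneg k
  calc _ ≤ 2 * Real.pi * freqNorm k * ((r - s) / (4 * Real.pi)) := by gcongr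
    _ = _ := by
      field_simp
      ring

theorem hasSum_compOp_apply (hsr : s < r) {u : A' d s} (hu : ‖u‖ ≤ (r - s) / (4 * Real.pi))
    (f : A' d r) : HasSum (fun k => exp (phaseOp d s k u) (mode d 0 hs.out k (coeff f k)))
      (compOp d s r u f) := by
  have h : Summable fun k => modeTerm d s r k (exp (phaseOp d s k u)) := by
    refine Summable.of_norm_bounded
      (summable_exp_neg_freqNorm d (half_pos (sub_pos.mpr hsr))) fun k => ?_
    refine ((modeTerm d s r k).le_of_opNorm_le (norm_modeTerm_le k) _).trans ?_
    calc _ ≤ Real.exp (-((r - s) * freqNorm k)) * Real.exp ((r - s) / 2 * freqNorm k) :=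
          mul_le_mul_of_nonneg_left (norm_exp_phaseOp_le hu k) (Real.exp_nonneg _)
      _ = _ := by
          rw [← Real.exp_add]
          ring_nf
  exact h.hasSum.mapL (ContinuousLinearMap.apply ℂ (A d s) f)

/-- The phase contributes `(r - s)/2` to the exponent and the mode `s`, together `(r + s)/2 ≤ r`;
hence the constant is `1`. -/
theorem norm_compOp_apply_le (hsr : s < r) {u : A' d s} (hu : ‖u‖ ≤ (r - s) / (4 * Real.pi))
    (f : A' d r) : ‖compOp d s r u f‖ ≤ ‖f‖ := by
  rw [← (hasSum_compOp_apply hsr hu f).tsum_eq]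
  refine tsum_of_norm_bounded f.isField.summable.hasSum fun k => ?_
  calc _ ≤ Real.exp ((r - s) / 2 * freqNorm k) * (weight 0 s k * ‖coeff f k‖) := by
        refine (ContinuousLinearMap.le_opNorm _ _).trans (mul_le_mul
          (norm_exp_phaseOp_le hu k) ?_ (norm_nonneg _) (Real.exp_nonneg _))
        exact (mode d 0 hs.out k).le_of_opNorm_le (norm_mode_le hs.out k) _
    _ = Real.exp ((r + s) / 2 * freqNorm k) * ‖coeff f k‖ := by
        rw [weight_zero, ← mul_assoc, ← Real.exp_add]
        ring_nf
    _ ≤ Real.exp (r * freqNorm k) * ‖coeff f k‖ := by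
        have h0 := freqNorm_nonneg k
        gcongr
        linarith
    _ ≤ _ := mul_le_mul_of_nonneg_right (exp_le_weight 1 r k) (norm_nonneg _)

theorem add_mem_strip (hsr : s < r) {u : A' d s} (hu : ‖u‖ ≤ (r - s) / (4 * Real.pi)) {θ : Vec d}
    (hθ : θ ∈ strip d s) : θ + u θ ∈ strip d r := by
  have h1 : ∑ i, |(u θ i).im| ≤ (r - s) / (4 * Real.pi) := by
    calc _ ≤ ∑ i, ‖u θ i‖ := Finset.sum_le_sum fun i _ => Complex.abs_im_le_norm _
      _ = ‖u θ‖ := (PiLp.norm_eq_of_L1 _).symm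
      _ ≤ _ := (u.norm_apply_le hs.out hθ).trans hu
  have h2 : ∑ i, |(θ i).im| < s / (2 * Real.pi) := hθ
  change ∑ i, |((θ + u θ) i).im| < r / (2 * Real.pi)
  calc _ ≤ ∑ i, (|(θ i).im| + |(u θ i).im|) := Finset.sum_le_sum fun i _ => by
        rw [PiLp.add_apply, Complex.add_im]
        exact abs_add_le _ _
    _ < s / (2 * Real.pi) + (r - s) / (4 * Real.pi) := by
        rw [Finset.sum_add_distrib]
        linarith
    _ ≤ s / (2 * Real.pi) + (r - s) / (2 * Real.pi) := by
        have := (sub_pos.mpr hsr).le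
        gcongr
        norm_num
    _ = _ := by ring

/-- Evaluation at `θ` turns multiplication by `2πi k·u` into a scalar, so the operator exponential
becomes `e^{2πi k·u(θ)}`, the factor that the `k`-th character acquires under the shift by `u(θ)`.
-/
theorem compOp_apply (hsr : s < r) {u : A' d s} (hu : ‖u‖ ≤ (r - s) / (4 * Real.pi))
    (f : A' d r) {θ : Vec d} (hθ : θ ∈ strip d s) :
    compOp d s r u f θ = f (θ + u θ) := by
  have h1 := (hasSum_compOp_apply hsr hu f).mapL (evalL 0 hs.out hθ)
  have h2 := f.hasSum_apply (hs.out.trans hsr) (add_mem_strip hsr hu hθ)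
  refine h1.unique (h2.congr_fun fun k => ?_)
  rw [apply_exp_of_apply_eq_smul (c := freqL k (u θ)) (fun g => phaseOp_apply k u g hθ),
    evalL_apply, mode_apply hs.out _ _ hθ, smul_smul, character, character, dot_add_left, mul_add,
    Complex.exp_add, mul_comm, freqL_apply]

theorem compOp_constField (hsr : s < r) {u : A' d s} (hu : ‖u‖ ≤ (r - s) / (4 * Real.pi))
    (c : Vec d) : compOp d s r u (constField 1 r c) = mode d 0 hs.out 0 c := by
  refine FieldSpace.ext_strip fun θ hθ => ?_
  rw [compOp_apply hsr hu _ hθ, mode_zero_eq_constField]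
  exact (Set.indicator_of_mem (add_mem_strip hsr hu hθ) fun _ => c).trans
    (Set.indicator_of_mem hθ fun _ => c).symm

theorem fourierProj_univ (hr : 0 < r) {j : ℕ} (f : FieldSpace d j r) {θ : Vec d}
    (hθ : θ ∈ strip d r) : fourierProj Set.univ f θ = f θ := by
  rw [fourierProj, tsum_univ fun k => character k θ • coeff f k]
  exact (f.hasSum_apply hr hθ).tsum_eq

theorem compOp_zero (hsr : s < r) : compOp d s r 0 = projOp hsr.le 1 Set.univ := by
  have h0 : ‖(0 : A' d s)‖ ≤ (r - s) / (4 * Real.pi) := by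
    rw [norm_zero]
    exact div_nonneg (sub_pos.mpr hsr).le (by positivity)
  ext f
  refine FieldSpace.ext_strip fun θ hθ => ?_
  rw [compOp_apply hsr h0 f hθ, projOp_apply hsr.le 1 _ f hθ]
  have h := add_mem_strip hsr h0 hθ
  simp only [FieldSpace.coe_zero, Pi.zero_apply, add_zero] at h ⊢
  exact (fourierProj_univ (hs.out.trans hsr) f h).symm

end

end TorusField

/-! ### Fixed points of bounded holomorphic maps and their dependence on a parameter. -/

section General

variable {E F : Type*} [NormedAddCommGroup E] [NormedSpace ℂ E] [NormedAddCommGroup F]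
  [NormedSpace ℂ F]

theorem isInvertible_of_isUnit {S : E →L[ℂ] E} (h : IsUnit S) : S.IsInvertible := by
  obtain ⟨a, rfl⟩ := h
  exact ⟨ContinuousLinearEquiv.ofUnit a, rfl⟩

/-- A holomorphic map on the ball of radius `m` about `0` that is bounded by `m / 3`, and by
`m / 6` on the ball of radius `m / 3`, has a small derivative on the latter ball. -/
theorem norm_fderiv_le_of_bounds {T : E → F} {m : ℝ} (hm : 0 < m)
    (hd : DifferentiableOn ℂ T (Metric.ball 0 m)) (h1 : ∀ u, ‖u‖ < m → ‖T u‖ ≤ m / 3)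
    (h2 : ∀ u, ‖u‖ ≤ m / 3 → ‖T u‖ ≤ m / 6) {u : E} (hu : ‖u‖ ≤ m / 3) :
    ‖fderiv ℂ T u‖ ≤ 3 / 4 := by
  -- On this ball `T` differs from `T u` by at most `m/3 + m/6 = m/2`, and Cauchy's estimate gives
  -- `(m/2) / (2m/3) = 3/4`.
  have hsub : Metric.ball u (2 * m / 3) ⊆ Metric.ball 0 m :=
    Metric.ball_subset_ball' (by rw [dist_zero_right]; linarith)
  refine (Complex.norm_fderiv_le_div_of_mapsTo_ball (R₂ := m / 2) (hd.mono hsub) (fun v hv => ?_)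
    (by positivity)).trans (le_of_eq (by field_simp; norm_num))
  rw [Metric.mem_closedBall, dist_eq_norm]
  have := h1 v (by simpa using hsub hv)
  have := h2 u hu
  linarith [norm_sub_le (T v) (T u)]

theorem norm_sub_le_of_bounds {T : E → F} {m : ℝ} (hm : 0 < m)
    (hd : DifferentiableOn ℂ T (Metric.ball 0 m)) (h1 : ∀ u, ‖u‖ < m → ‖T u‖ ≤ m / 3)
    (h2 : ∀ u, ‖u‖ ≤ m / 3 → ‖T u‖ ≤ m / 6) {u v : E} (hu : ‖u‖ ≤ m / 3) (hv : ‖v‖ ≤ m / 3) :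
    ‖T u - T v‖ ≤ 3 / 4 * ‖u - v‖ := by
  have := NormedSpace.restrictScalars ℝ ℂ E
  refine Convex.norm_image_sub_le_of_norm_fderiv_le (𝕜 := ℂ) (s := Metric.closedBall (0 : E) (m / 3))
    (fun x hx => ?_) (fun x hx => ?_) (convex_closedBall 0 (m / 3)) (by simpa using hv)
    (by simpa using hu)
  · have hx' : ‖x‖ ≤ m / 3 := by simpa using hx
    exact hd.differentiableAt (Metric.isOpen_ball.mem_nhds (by
      rw [mem_ball_zero_iff]
      linarith))
  · exact norm_fderiv_le_of_bounds hm hd h1 h2 (by simpa using hx)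

theorem existsUnique_fixedPoint_of_bounds [CompleteSpace E] {T : E → E} {m : ℝ} (hm : 0 < m)
    (hd : DifferentiableOn ℂ T (Metric.ball 0 m)) (h1 : ∀ u, ‖u‖ < m → ‖T u‖ ≤ m / 3)
    (h2 : ∀ u, ‖u‖ ≤ m / 3 → ‖T u‖ ≤ m / 6) : ∃! u, ‖u‖ ≤ m / 3 ∧ T u = u := by
  have hmaps : Set.MapsTo T (Metric.closedBall 0 (m / 3)) (Metric.closedBall 0 (m / 3)) := by
    intro u hu
    have := h2 u (by simpa using hu)
    rw [mem_closedBall_zero_iff]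
    linarith
  have hlip : LipschitzOnWith (3 / 4) T (Metric.closedBall 0 (m / 3)) := by
    refine LipschitzOnWith.of_dist_le_mul fun u hu v hv => ?_
    rw [dist_eq_norm, dist_eq_norm]
    simpa using norm_sub_le_of_bounds hm hd h1 h2 (by simpa using hu) (by simpa using hv)
  obtain ⟨u, hu, hfix, -⟩ := ContractingWith.exists_fixedPoint' (K := 3 / 4)
    Metric.isClosed_closedBall.isComplete hmaps
    ⟨by rw [← NNReal.coe_lt_coe]; norm_num, hlip.mapsToRestrict hmaps⟩
    (Metric.mem_closedBall_self (by positivity)) (edist_ne_top _ _)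
  refine ⟨u, ⟨by simpa using hu, hfix⟩, fun v ⟨hv, hv'⟩ => ?_⟩
  have h := norm_sub_le_of_bounds hm hd h1 h2 hv (by simpa using hu)
  rw [hv', hfix] at h
  have : ‖v - u‖ ≤ 0 := by linarith
  exact sub_eq_zero.mp (norm_le_zero_iff.mp this)

/-- The fixed point of an analytic family of maps, locally unique and with a small derivative,
depends analytically on the parameter. -/
theorem contDiffAt_fixedPoint [CompleteSpace E] [CompleteSpace F] {T : F × E → E} {x : F}
    {φ : F → E} {R c : ℝ} (hc : c < 1) (hT : ContDiffAt ℂ (⊤ : WithTop ℕ∞) T (x, φ x))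
    (hT' : ‖fderiv ℂ (fun v => T (x, v)) (φ x)‖ ≤ c) (hx : ‖φ x‖ < R) (hfix : T (x, φ x) = φ x)
    (huniq : ∀ᶠ y in nhds x, ∀ v, ‖v‖ ≤ R → T (y, v) = v → v = φ y) :
    ContDiffAt ℂ (⊤ : WithTop ℕ∞) φ x := by
  set G : F × E → E := fun z => z.2 - T z with hG
  have hGc : ContDiffAt ℂ (⊤ : WithTop ℕ∞) G (x, φ x) := contDiffAt_snd.sub hT
  have hinv : (fderiv ℂ G (x, φ x) ∘L .inr ℂ F E).IsInvertible := by
    have hTd : DifferentiableAt ℂ T (x, φ x) := hT.differentiableAt (by simp)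
    have hpair : HasFDerivAt (fun v : E => (x, v)) (.inr ℂ F E) (φ x) :=
      hasFDerivAt_prodMk_right x (φ x)
    have e1 : fderiv ℂ (fun v => T (x, v)) (φ x) = fderiv ℂ T (x, φ x) ∘L .inr ℂ F E :=
      (hTd.hasFDerivAt.comp (φ x) hpair).fderiv
    have e2 : fderiv ℂ G (x, φ x) ∘L .inr ℂ F E =
        1 + -fderiv ℂ (fun v => T (x, v)) (φ x) := by
      have e3 : HasFDerivAt G (.snd ℂ F E - fderiv ℂ T (x, φ x)) (x, φ x) :=
        hasFDerivAt_snd.sub hTd.hasFDerivAt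
      rw [e1, e3.fderiv]
      ext v
      simp [sub_eq_add_neg]
    rw [e2]
    exact isInvertible_of_isUnit (isUnit_one_add_of_norm_lt_one (by rw [norm_neg]; linarith))
  have hψ := hGc.contDiffAt_implicitFunction (by simp) hinv
  have hψ0 := hGc.implicitFunction_apply_self (by simp) hinv
  have hψe := hGc.eventually_apply_implicitFunction (by simp) hinv
  set ψ := hGc.implicitFunction (by simp) hinv
  simp only at hψ hψ0 hψe
  refine hψ.congr_of_eventuallyEq ?_
  -- The implicit branch starts strictly inside the ball of radius `R`, so it stays there for nearby
  -- parameters; there fixed points are unique, and it coincides with `φ`.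
  have hn : ∀ᶠ y in nhds x, ‖ψ y‖ < R := by
    refine hψ.continuousAt.norm.eventually_lt_const ?_
    simpa only [hψ0] using hx
  filter_upwards [hψe, huniq, hn] with y h1 h2 h3
  refine (h2 _ h3.le ?_).symm
  simp only [hG, hfix, sub_self] at h1
  exact (sub_eq_zero.mp h1).symm

end General

/-! ### Biholomorphy of Lipschitz perturbations of the identity. -/

namespace TorusField

/-- A perturbation of the identity with Lipschitz constant below `1` is injective with open image.
Its inverse is holomorphic by the inverse function theorem, as the derivatives are invertible. -/
theorem isCoordChange_of_lipschitz {d : ℕ} {S S' : Set (Vec d)} {U : Vec d → Vec d}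
    {U' : Vec d → Vec d →L[ℂ] Vec d} {c : NNReal} (hc : c < 1) (hS : IsOpen S)
    (hmaps : Set.MapsTo U S S') (hU : ∀ θ ∈ S, HasFDerivAt U (U' θ) θ)
    (hinv : ∀ θ ∈ S, (U' θ).IsInvertible)
    (hlip : LipschitzOnWith c (fun θ => U θ - θ) S) : IsCoordChange U S S' := by
  have happ : ApproximatesLinearOn U
      ((ContinuousLinearEquiv.refl ℂ (Vec d) : Vec d ≃L[ℂ] Vec d) : Vec d →L[ℂ] Vec d) S c := by
    intro x hx y hy
    have := hlip.dist_le_mul x hx y hy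
    rw [dist_eq_norm, dist_eq_norm] at this
    convert! this using 2
    simp only [ContinuousLinearEquiv.coe_refl, ContinuousLinearMap.id_apply]
    abel
  -- The first alternative covers `d = 0`, where the identity has norm zero.
  have hN : Subsingleton (Vec d) ∨ c < ‖((ContinuousLinearEquiv.refl ℂ (Vec d)).symm :
      Vec d →L[ℂ] Vec d)‖₊⁻¹ := by
    rcases (ContinuousLinearEquiv.refl ℂ (Vec d)).subsingleton_or_nnnorm_symm_pos with h | h
    · exact Or.inl h
    · refine Or.inr (hc.trans_le ((one_le_inv₀ h).mpr ?_))
      exact ContinuousLinearMap.norm_id_le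
  let e := happ.toOpenPartialHomeomorph U S hN hS
  refine ⟨hmaps, fun θ hθ => (hU θ hθ).differentiableAt.differentiableWithinAt, e.open_target,
    e.symm, ?_, fun θ hθ => e.left_inv hθ⟩
  rintro _ ⟨θ, hθ, rfl⟩
  obtain ⟨L, hL⟩ := hinv θ hθ
  have hθ' : e.symm (U θ) = θ := e.left_inv hθ
  refine (OpenPartialHomeomorph.hasFDerivAt_symm e (f' := L) (a := U θ) ⟨θ, hθ, rfl⟩
    ?_).differentiableAt.differentiableWithinAt
  rw [hθ', hL]
  exact hU θ hθ

end TorusField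

/-! ### The displacement, the normal form and its derivative. -/

namespace TorusField

noncomputable section

/-- The smallness conditions on the radius `m` of the ball of displacements. -/
structure IsAdmissible (s r σ m w : ℝ) : Prop where
  lt : s < r
  σ_pos : 0 < σ
  pos : 0 < m
  le_strip : m ≤ (r - s) / (4 * Real.pi)
  le_tenth : m ≤ 1 / 10
  mul_le : m * w ≤ σ / 10

variable {d : ℕ} {s : ℝ} [hs : Fact (0 < s)] {r σ m : ℝ} {ω : Vec d}

/-- The field `(I + Du)⁻¹ ((Du)² ω + (X - ω) ∘ (id + u))`, as a function of `(X, u)`. -/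
def remainder (s r : ℝ) [hs : Fact (0 < s)] (ω : Vec d) (z : A' d r × A' d s) : A d s :=
  Ring.inverse (1 + jacobianOp d s z.2)
    (jacobianOp d s z.2 (jacobianOp d s z.2 (mode d 0 hs.out 0 ω)) +
      compOp d s r z.2 (z.1 - constField 1 r ω))

theorem one_add_jacobianOp_remainder {X : A' d r} {u : A' d s} (hu : ‖u‖ < 1) :
    remainder s r ω (X, u) + jacobianOp d s u (remainder s r ω (X, u)) =
      jacobianOp d s u (jacobianOp d s u (mode d 0 hs.out 0 ω)) +
      compOp d s r u (X - constField 1 r ω) := by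
  have h := Ring.mul_inverse_cancel _
    (isUnit_one_add_of_norm_lt_one ((norm_jacobianOp_apply_le u).trans_lt hu))
  have h' := congrArg (fun T : A d s →L[ℂ] A d s =>
    T (jacobianOp d s u (jacobianOp d s u (mode d 0 hs.out 0 ω)) +
      compOp d s r u (X - constField 1 r ω))) h
  exact h'

theorem norm_mode_zero_le (v : Vec d) : ‖mode d 0 hs.out 0 v‖ ≤ ‖v‖ := by
  refine ((mode d 0 hs.out 0).le_of_opNorm_le (norm_mode_le hs.out 0) v).trans (le_of_eq ?_)
  simp [weight, freqNorm]

theorem IsAdmissible.norm_remainder_le (h : IsAdmissible s r σ m ‖ω‖) (X : A' d r) {u : A' d s}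
    (hu : ‖u‖ ≤ m) :
    ‖remainder s r ω (X, u)‖ ≤ σ / 9 * ‖u‖ + 10 / 9 * ‖X - constField 1 r ω‖ := by
  have hJ := norm_jacobianOp_apply_le u
  have hu1 : ‖u‖ ≤ 1 / 10 := hu.trans h.le_tenth
  have h1 : ‖Ring.inverse (1 + jacobianOp d s u)‖ ≤ 10 / 9 := by
    refine (norm_inverse_one_add_le (hJ.trans_lt (by linarith))).trans ?_
    rw [inv_le_comm₀ (by linarith) (by norm_num)]
    norm_num
    linarith
  -- This term is quadratic in `u`. Bounding one factor by `m` and using `m‖ω‖ ≤ σ/10` keeps it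
  -- small after the later multiplication by `2/σ`.
  have h2 : ‖jacobianOp d s u (jacobianOp d s u (mode d 0 hs.out 0 ω))‖ ≤ σ / 10 * ‖u‖ := by
    calc _ ≤ ‖u‖ * (‖u‖ * ‖ω‖) := by
          refine ((jacobianOp d s u).le_of_opNorm_le hJ _).trans
            (mul_le_mul_of_nonneg_left ?_ (norm_nonneg _))
          exact ((jacobianOp d s u).le_of_opNorm_le hJ _).trans
            (mul_le_mul_of_nonneg_left (norm_mode_zero_le ω) (norm_nonneg _))
      _ ≤ ‖u‖ * (m * ‖ω‖) := by gcongr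
      _ ≤ ‖u‖ * (σ / 10) := mul_le_mul_of_nonneg_left h.mul_le (norm_nonneg _)
      _ = _ := by ring
  have h3 := norm_compOp_apply_le h.lt (hu.trans h.le_strip) (X - constField 1 r ω)
  refine (ContinuousLinearMap.le_of_opNorm_le _ h1 _).trans ?_
  have h4 := (norm_add_le (jacobianOp d s u (jacobianOp d s u (mode d 0 hs.out 0 ω)))
    (compOp d s r u (X - constField 1 r ω))).trans (add_le_add h2 h3)
  linarith [mul_le_mul_of_nonneg_left h4 (by norm_num : (0 : ℝ) ≤ 10 / 9)]

/-- The exponent `⊤ : WithTop ℕ∞` means analyticity. Inversion is analytic at units, composition by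
its power series, and the rest is linear or bilinear. -/
theorem IsAdmissible.contDiffAt_remainder (h : IsAdmissible s r σ m ‖ω‖) (X : A' d r) {u : A' d s}
    (hu : ‖u‖ < m) : ContDiffAt ℂ (⊤ : WithTop ℕ∞) (remainder s r ω) (X, u) := by
  have hJ : ContDiffAt ℂ (⊤ : WithTop ℕ∞) (fun z : A' d r × A' d s => jacobianOp d s z.2) (X, u) :=
    (jacobianOp d s).contDiff.contDiffAt.comp (X, u) contDiffAt_snd
  have hC : ContDiffAt ℂ (⊤ : WithTop ℕ∞) (fun z : A' d r × A' d s => compOp d s r z.2) (X, u) := by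
    have := (analyticOnNhd_compOp (d := d) h.lt u (by
      rw [mem_ball_zero_iff]
      exact hu.trans_le h.le_strip)).contDiffAt (n := (⊤ : WithTop ℕ∞))
    exact this.comp (X, u) contDiffAt_snd
  have hI : ContDiffAt ℂ (⊤ : WithTop ℕ∞)
      (fun z : A' d r × A' d s => Ring.inverse (1 + jacobianOp d s z.2)) (X, u) := by
    obtain ⟨a, ha⟩ := isUnit_one_add_of_norm_lt_one
      ((norm_jacobianOp_apply_le u).trans_lt (by linarith [h.le_tenth] : ‖u‖ < 1))
    have := contDiffAt_ringInverse ℂ (n := (⊤ : WithTop ℕ∞)) a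
    rw [ha] at this
    exact this.comp (X, u) (contDiffAt_const.add hJ)
  exact hI.clm_apply ((hJ.clm_apply (hJ.clm_apply contDiffAt_const)).add
    (hC.clm_apply (contDiffAt_fst.sub contDiffAt_const)))

/-- The displacements of the normalizing coordinate changes are the fixed points of this map. -/
def displacementMap (s r : ℝ) [Fact (0 < s)] {σ : ℝ} (hσ : 0 < σ) (ω : Vec d)
    (z : A' d r × A' d s) : A' d s := solveOp s hσ ω (remainder s r ω z)

theorem IsAdmissible.contDiffAt_displacementMap (h : IsAdmissible s r σ m ‖ω‖) (X : A' d r)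
    {u : A' d s} (hu : ‖u‖ < m) :
    ContDiffAt ℂ (⊤ : WithTop ℕ∞) (displacementMap s r h.σ_pos ω) (X, u) :=
  (solveOp s h.σ_pos ω).contDiff.contDiffAt.comp (X, u) (h.contDiffAt_remainder X hu)

theorem IsAdmissible.norm_displacementMap_le (h : IsAdmissible s r σ m ‖ω‖) (X : A' d r)
    {u : A' d s} (hu : ‖u‖ ≤ m) :
    ‖displacementMap s r h.σ_pos ω (X, u)‖ ≤
      2 / 9 * ‖u‖ + 20 / 9 * (‖X - constField 1 r ω‖ / σ) := by
  have hσ := h.σ_pos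
  refine (norm_solveOp_apply_le h.σ_pos ω _).trans ?_
  calc _ ≤ 2 / σ * (σ / 9 * ‖u‖ + 10 / 9 * ‖X - constField 1 r ω‖) :=
        mul_le_mul_of_nonneg_left (h.norm_remainder_le X hu) (by positivity)
    _ = _ := by
        field_simp
        ring

variable {X : A' d r}

theorem IsAdmissible.differentiableOn (h : IsAdmissible s r σ m ‖ω‖) (X : A' d r) :
    DifferentiableOn ℂ (fun u => displacementMap s r h.σ_pos ω (X, u)) (Metric.ball 0 m) := by
  intro u hu
  have h1 := (h.contDiffAt_displacementMap X (by simpa using hu)).differentiableAt (by simp)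
  exact (h1.comp u (hasFDerivAt_prodMk_right X u).differentiableAt).differentiableWithinAt

/-- The threshold `σm/26` serves both this bound, as `2/9 + 20/(9·26) < 1/3`, and the one on the
smaller ball, as `2/27 + 20/(9·26) < 1/6`. -/
theorem IsAdmissible.norm_le_third (h : IsAdmissible s r σ m ‖ω‖)
    (hX : ‖X - constField 1 r ω‖ < σ * m / 26) (u : A' d s) (hu : ‖u‖ < m) :
    ‖displacementMap s r h.σ_pos ω (X, u)‖ ≤ m / 3 := by
  have hm := h.pos
  have h1 := h.norm_displacementMap_le X hu.le
  have h2 : ‖X - constField 1 r ω‖ / σ < m / 26 := by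
    rw [div_lt_iff₀ h.σ_pos]
    linarith
  linarith

theorem IsAdmissible.norm_le_sixth (h : IsAdmissible s r σ m ‖ω‖)
    (hX : ‖X - constField 1 r ω‖ < σ * m / 26) (u : A' d s) (hu : ‖u‖ ≤ m / 3) :
    ‖displacementMap s r h.σ_pos ω (X, u)‖ ≤ m / 6 := by
  have hm := h.pos
  have h1 := h.norm_displacementMap_le X (by linarith : ‖u‖ ≤ m)
  have h2 : ‖X - constField 1 r ω‖ / σ < m / 26 := by
    rw [div_lt_iff₀ h.σ_pos]
    linarith
  linarith

theorem IsAdmissible.existsUnique_displacement (h : IsAdmissible s r σ m ‖ω‖)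
    (hX : ‖X - constField 1 r ω‖ < σ * m / 26) :
    ∃! u : A' d s, ‖u‖ ≤ m / 3 ∧ displacementMap s r h.σ_pos ω (X, u) = u :=
  existsUnique_fixedPoint_of_bounds h.pos (h.differentiableOn X) (h.norm_le_third hX)
    (h.norm_le_sixth hX)

open Classical in
/-- The displacement `u` of the coordinate change `id + u`. -/
def IsAdmissible.displacement (h : IsAdmissible s r σ m ‖ω‖) (X : A' d r) : A' d s :=
  -- The value `0` away from the ball is arbitrary.
  if hX : ‖X - constField 1 r ω‖ < σ * m / 26 then (h.existsUnique_displacement hX).choose else 0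

theorem IsAdmissible.displacement_spec (h : IsAdmissible s r σ m ‖ω‖)
    (hX : ‖X - constField 1 r ω‖ < σ * m / 26) :
    ‖h.displacement X‖ ≤ m / 3 ∧
      displacementMap s r h.σ_pos ω (X, h.displacement X) = h.displacement X := by
  rw [displacement, dif_pos hX]
  exact (h.existsUnique_displacement hX).choose_spec.1

theorem IsAdmissible.displacement_unique (h : IsAdmissible s r σ m ‖ω‖)
    (hX : ‖X - constField 1 r ω‖ < σ * m / 26) {u : A' d s} (hu : ‖u‖ ≤ m / 3)
    (hfix : displacementMap s r h.σ_pos ω (X, u) = u) : u = h.displacement X :=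
  (h.existsUnique_displacement hX).unique ⟨hu, hfix⟩ (h.displacement_spec hX)

/-- At a fixed point the bound on the map is self-improving: absorbing `2/9 ‖u‖` on the left gives
the constant `20/7 ≤ 3`. -/
theorem IsAdmissible.norm_displacement_le (h : IsAdmissible s r σ m ‖ω‖)
    (hX : ‖X - constField 1 r ω‖ < σ * m / 26) :
    ‖h.displacement X‖ ≤ 3 * (‖X - constField 1 r ω‖ / σ) := by
  obtain ⟨h1, h2⟩ := h.displacement_spec hX
  have h3 := h.norm_displacementMap_le X (by linarith [h.pos] : ‖h.displacement X‖ ≤ m)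
  rw [h2] at h3
  have : 0 ≤ ‖X - constField 1 r ω‖ / σ := div_nonneg (norm_nonneg _) h.σ_pos.le
  linarith

theorem IsAdmissible.contDiffAt_displacement [Fact (0 < r)] (h : IsAdmissible s r σ m ‖ω‖)
    (hX : ‖X - constField 1 r ω‖ < σ * m / 26) :
    ContDiffAt ℂ (⊤ : WithTop ℕ∞) h.displacement X := by
  obtain ⟨h1, h2⟩ := h.displacement_spec hX
  have hm := h.pos
  -- The fixed point is its own image, hence of norm at most `m/6`; the implicit function argument
  -- needs this strict inequality.
  have hlt : ‖h.displacement X‖ < m / 3 := by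
    have := h.norm_le_sixth hX _ h1
    rw [h2] at this
    linarith
  refine contDiffAt_fixedPoint (T := displacementMap s r h.σ_pos ω) (R := m / 3)
    (by norm_num : (3 / 4 : ℝ) < 1) (h.contDiffAt_displacementMap X (by linarith))
    (norm_fderiv_le_of_bounds hm (h.differentiableOn X) (h.norm_le_third hX) (h.norm_le_sixth hX)
      h1) hlt h2 ?_
  have hopen : ∀ᶠ Y in nhds X, ‖Y - constField 1 r ω‖ < σ * m / 26 :=
    (continuous_id.sub continuous_const).norm.continuousAt.eventually_lt_const hX
  filter_upwards [hopen] with Y hY v hv hv'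
  exact h.displacement_unique hY hv hv'

/-- The normalized vector field. -/
def IsAdmissible.normalForm (h : IsAdmissible s r σ m ‖ω‖) (X : A' d r) : A d s :=
  mode d 0 hs.out 0 ω +
    projOp le_rfl 0 (resonantIndices σ ω) (remainder s r ω (X, h.displacement X))

theorem IsAdmissible.contDiffAt_normalForm [Fact (0 < r)] (h : IsAdmissible s r σ m ‖ω‖)
    (hX : ‖X - constField 1 r ω‖ < σ * m / 26) :
    ContDiffAt ℂ (⊤ : WithTop ℕ∞) h.normalForm X := by
  have hm := h.pos
  have h1 : ContDiffAt ℂ (⊤ : WithTop ℕ∞) (fun Y => (Y, h.displacement Y)) X :=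
    contDiffAt_id.prodMk (h.contDiffAt_displacement hX)
  have h2 := (h.contDiffAt_remainder X
    (by linarith [(h.displacement_spec hX).1] : ‖h.displacement X‖ < m)).comp X h1
  exact contDiffAt_const.add ((projOp le_rfl 0
    (resonantIndices σ ω)).contDiff.contDiffAt.comp X h2)

theorem projOp_compl_add (I : Set (Fin d → ℤ)) (g : A d s) :
    projOp le_rfl 0 Iᶜ g + projOp le_rfl 0 I g = g := by
  refine FieldSpace.ext_coeff fun k => ?_
  rw [FieldSpace.coeff_add, coeff_projOp, coeff_projOp]
  by_cases hk : k ∈ I <;> simp [hk]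

/-- The conjugacy equation before division by `1 + Du`. With `w` the remainder, `N = ω + w - (Du)
ω`; in `N + (Du) N` the linear terms `(Du) ω` cancel and the equation defining `w` removes `(Du)²
ω`. -/
theorem IsAdmissible.normalForm_add (h : IsAdmissible s r σ m ‖ω‖)
    (hX : ‖X - constField 1 r ω‖ < σ * m / 26) :
    h.normalForm X + jacobianOp d s (h.displacement X) (h.normalForm X) =
      compOp d s r (h.displacement X) X := by
  have hm := h.pos
  obtain ⟨h1, h2⟩ := h.displacement_spec hX
  set u := h.displacement X with hu
  have hum : ‖u‖ ≤ m := by linarith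
  have h3 := one_add_jacobianOp_remainder (ω := ω) (X := X)
    (by linarith [h.le_tenth] : ‖u‖ < 1)
  have h4 := jacobianOp_solveOp h.σ_pos ω (remainder s r ω (X, u))
  rw [show solveOp s h.σ_pos ω (remainder s r ω (X, u)) = u from h2] at h4
  have h5 := projOp_compl_add (farIndices σ ω) (remainder s r ω (X, u))
  have h6 : h.normalForm X = mode d 0 hs.out 0 ω + (remainder s r ω (X, u) -
      jacobianOp d s u (mode d 0 hs.out 0 ω)) := by
    rw [normalForm, h4]
    congr 1
    exact eq_sub_of_add_eq h5
  have h7 := compOp_constField h.lt (hum.trans h.le_strip) ω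
  rw [map_sub, h7] at h3
  rw [h6, map_add, map_sub]
  rw [← sub_eq_iff_eq_add'] at h3
  rw [← sub_eq_zero] at h3 ⊢
  rw [← h3]
  abel

theorem zero_mem_resonantIndices : (0 : Fin d → ℤ) ∈ resonantIndices σ ω := by
  simp [resonantIndices, farIndices, dot_zero_right, freqNorm]

theorem IsAdmissible.projOp_normalForm (h : IsAdmissible s r σ m ‖ω‖) (X : A' d r) :
    projOp le_rfl 0 (resonantIndices σ ω) (h.normalForm X) = h.normalForm X := by
  rw [normalForm, map_add]
  congr 1
  · rw [projOp_mode, Set.indicator_of_mem (zero_mem_resonantIndices)]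
  · refine FieldSpace.ext_coeff fun k => ?_
    rw [coeff_projOp, coeff_projOp]
    by_cases hk : k ∈ resonantIndices σ ω <;> simp [hk, coeff_projOp]

/-- The displacement contributes `1/3` and the perturbation itself `10/9`, in total less than `2`.
-/
theorem IsAdmissible.norm_normalForm_sub_le (h : IsAdmissible s r σ m ‖ω‖)
    (hX : ‖X - constField 1 r ω‖ < σ * m / 26) :
    ‖h.normalForm X - constField 0 s ω‖ ≤ 2 * ‖X - constField 1 r ω‖ := by
  have hm := h.pos
  have h1 := h.norm_displacement_le hX
  have h2 := h.norm_remainder_le X (by linarith [(h.displacement_spec hX).1] :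
    ‖h.displacement X‖ ≤ m)
  rw [normalForm, mode_zero_eq_constField, add_sub_cancel_left]
  refine (norm_projOp_apply_le le_rfl 0 _ _).trans (h2.trans ?_)
  have h3 : σ / 9 * ‖h.displacement X‖ ≤ σ / 9 * (3 * (‖X - constField 1 r ω‖ / σ)) :=
    mul_le_mul_of_nonneg_left h1 (by linarith [h.σ_pos])
  have h4 : σ / 9 * (3 * (‖X - constField 1 r ω‖ / σ)) = 1 / 3 * ‖X - constField 1 r ω‖ := by
    have := h.σ_pos.ne'
    field_simp
    norm_num
  linarith [norm_nonneg (X - constField 1 r ω)]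

/-- At `u = 0` the remainder is the restriction of `X - ω`, which has no far modes because the
frequency `0` is resonant. The solution operator annihilates it, so `0` is a fixed point, and the
only one. -/
theorem IsAdmissible.displacement_eq_zero (h : IsAdmissible s r σ m ‖ω‖)
    (hX : ‖X - constField 1 r ω‖ < σ * m / 26) (h0 : ∀ k ∈ farIndices σ ω, coeff X k = 0) :
    h.displacement X = 0 := by
  have hm := h.pos
  have hr : 0 < r := hs.out.trans h.lt
  refine (h.displacement_unique hX (by rw [norm_zero]; positivity) ?_).symm
  have h1 : remainder s r ω (X, 0) = projOp h.lt.le 1 Set.univ (X - constField 1 r ω) := by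
    simp [remainder, compOp_zero h.lt]
  rw [displacementMap, h1, solveOp]
  refine (hasSum_lift (norm_solveOp_aux h.σ_pos ω) _).unique ?_
  convert! hasSum_zero using 1
  funext k
  by_cases hk : k ∈ farIndices σ ω
  · have hk0 : k ≠ 0 := by
      rintro rfl
      exact zero_mem_resonantIndices hk
    have h2 : coeff (projOp h.lt.le 1 Set.univ (X - constField 1 r ω)) k = 0 := by
      rw [coeff_projOp, Set.indicator_univ, ← coeffL_apply, map_sub, coeffL_apply, coeffL_apply,
        h0 k hk, ← mode_zero_eq_constField hr, coeff_mode, Pi.single_eq_of_ne hk0, sub_zero]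
    rw [h2, map_zero]
  · rw [Set.indicator_of_notMem hk]
    rfl

/-- With `Y₀` the constant field `c` on the smaller strip, subtract `X₀ ∘ (id + u) = Y₀` from the
conjugacy equation and project. As `(Du) Y₀` has only far modes, `N(X) = P((X - X₀) ∘ (id + u) -
(Du)(N(X) - Y₀)) + P Y₀`. At `X₀` both factors of the second product vanish, as does `X - X₀` in the
first, so the product rule leaves `P` after restriction and the derivative of `u` never enters. -/
theorem IsAdmissible.hasFDerivAt_normalForm [Fact (0 < r)] (h : IsAdmissible s r σ m ‖ω‖)
    (c : Vec d) (hc : ‖constField 1 r c - constField 1 r ω‖ < σ * m / 26) :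
    HasFDerivAt h.normalForm (projOp h.lt.le 1 (resonantIndices σ ω)) (constField 1 r c) := by
  have hm := h.pos
  have hr : 0 < r := hs.out.trans h.lt
  set X₀ : A' d r := constField 1 r c with hX₀
  set P : A d s →L[ℂ] A d s := projOp le_rfl 0 (resonantIndices σ ω) with hP
  set Y₀ : A d s := mode d 0 hs.out 0 c with hY₀
  have hu0 : h.displacement X₀ = 0 := by
    refine h.displacement_eq_zero hc fun k hk => ?_
    have hk0 : k ≠ 0 := by
      rintro rfl
      exact zero_mem_resonantIndices hk
    rw [hX₀, ← mode_zero_eq_constField hr, coeff_mode, Pi.single_eq_of_ne hk0]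
  have hzero : ‖(0 : A' d s)‖ ≤ (r - s) / (4 * Real.pi) := by
    rw [norm_zero]
    exact hm.le.trans h.le_strip
  have hN0 : h.normalForm X₀ = Y₀ := by
    have := h.normalForm_add hc
    rw [hu0, compOp_constField h.lt hzero] at this
    simpa using this
  have hu' : HasFDerivAt h.displacement (fderiv ℂ h.displacement X₀) X₀ :=
    ((h.contDiffAt_displacement hc).differentiableAt (by simp)).hasFDerivAt
  have hN' : HasFDerivAt h.normalForm (fderiv ℂ h.normalForm X₀) X₀ :=
    ((h.contDiffAt_normalForm hc).differentiableAt (by simp)).hasFDerivAt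
  have hC' : HasFDerivAt (fun X => compOp d s r (h.displacement X))
      ((fderiv ℂ (compOp d s r) 0).comp (fderiv ℂ h.displacement X₀)) X₀ := by
    have h1 : HasFDerivAt (compOp d s r) (fderiv ℂ (compOp d s r) 0) (h.displacement X₀) := by
      rw [hu0]
      exact (analyticOnNhd_compOp (d := d) h.lt 0
        (Metric.mem_ball_self (hm.trans_le h.le_strip))).differentiableAt.hasFDerivAt
    exact h1.comp X₀ hu'
  have hJ' : HasFDerivAt (fun X => jacobianOp d s (h.displacement X))
      ((jacobianOp d s).comp (fderiv ℂ h.displacement X₀)) X₀ :=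
    (jacobianOp d s).hasFDerivAt.comp X₀ hu'
  have hA := hC'.clm_apply ((hasFDerivAt_id X₀).sub_const X₀)
  have hB := hJ'.clm_apply (hN'.sub_const Y₀)
  have hD := (P.hasFDerivAt.comp X₀ (hA.sub hB)).add_const (P Y₀)
  have hL : P.comp (compOp d s r 0) = projOp h.lt.le 1 (resonantIndices σ ω) := by
    rw [compOp_zero h.lt]
    ext f
    refine FieldSpace.ext_coeff fun k => ?_
    rw [ContinuousLinearMap.comp_apply, hP, coeff_projOp, coeff_projOp]
    by_cases hk : k ∈ resonantIndices σ ω <;> simp [hk, coeff_projOp]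
  have hopen : ∀ᶠ Y in nhds X₀, ‖Y - constField 1 r ω‖ < σ * m / 26 :=
    (continuous_id.sub continuous_const).norm.continuousAt.eventually_lt_const hc
  have hD' := hD.congr_of_eventuallyEq (f₁ := h.normalForm) ?_
  · convert! hD' using 1
    rw [← hL]
    simp only [hu0, hN0, sub_self, map_zero, id_eq]
    ext f
    simp
  · filter_upwards [hopen] with X hX
    have hux : ‖h.displacement X‖ ≤ (r - s) / (4 * Real.pi) := by
      linarith [(h.displacement_spec hX).1, h.le_strip]
    have e1 := h.normalForm_add hX
    have e2 : P (jacobianOp d s (h.displacement X) Y₀) = 0 := by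
      rw [← (h.displacement_spec hX).2]
      exact projOp_jacobianOp_solveOp h.σ_pos ω c _
    have e3 : compOp d s r (h.displacement X) X₀ = Y₀ := compOp_constField h.lt hux c
    simp only [Function.comp_apply, Pi.sub_apply, id_eq, map_sub, e3, e2, ← e1, map_add]
    rw [h.projOp_normalForm]
    abel

end

end TorusField

/-! ### From operator identities back to pointwise statements. -/

namespace TorusField

section

variable {d : ℕ} {s : ℝ} [hs : Fact (0 < s)] {r σ m : ℝ} {ω : Vec d} {X : A' d r}

/-- Test the Jacobian operator on constant fields and evaluate at `θ`; neither step increases norms.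
-/
theorem norm_fderiv_apply_le (u : A' d s) {θ : Vec d} (hθ : θ ∈ strip d s) :
    ‖fderiv ℂ u θ‖ ≤ ‖u‖ := by
  refine ContinuousLinearMap.opNorm_le_bound _ (norm_nonneg _) fun v => ?_
  have h := jacobianOp_apply u (mode d 0 hs.out 0 v) hθ
  rw [mode_apply hs.out _ _ hθ, character_zero, one_smul] at h
  rw [← h]
  refine (FieldSpace.norm_apply_le hs.out _ hθ).trans ?_
  exact ((jacobianOp d s u).le_of_opNorm_le (norm_jacobianOp_apply_le u) _).trans
    (mul_le_mul_of_nonneg_left (norm_mode_zero_le v) (norm_nonneg _))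

theorem hasFDerivAt_id_add (u : A' d s) {θ : Vec d} (hθ : θ ∈ strip d s) :
    HasFDerivAt (fun θ => θ + u θ) (1 + fderiv ℂ u θ) θ := by
  have h := (u.hasFDerivAt hs.out hθ).differentiableAt.hasFDerivAt
  exact (hasFDerivAt_id θ).add h

theorem isInvertible_one_add_fderiv {u : A' d s} (hu : ‖u‖ < 1) {θ : Vec d}
    (hθ : θ ∈ strip d s) : (1 + fderiv ℂ u θ).IsInvertible :=
  isInvertible_of_isUnit (isUnit_one_add_of_norm_lt_one ((norm_fderiv_apply_le u hθ).trans_lt hu))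

theorem isCoordChange_id_add (hsr : s < r) {u : A' d s} (hu : ‖u‖ ≤ (r - s) / (4 * Real.pi))
    (hu1 : ‖u‖ < 1) : IsCoordChange (fun θ => θ + u θ) (strip d s) (strip d r) := by
  refine isCoordChange_of_lipschitz (c := ‖u‖₊) (U' := fun θ => 1 + fderiv ℂ u θ)
    (by exact_mod_cast hu1) (isOpen_strip d s) (fun θ hθ => add_mem_strip hsr hu hθ)
    (fun θ hθ => hasFDerivAt_id_add u hθ) (fun θ hθ => isInvertible_one_add_fderiv hu1 hθ) ?_
  simp only [add_sub_cancel_left]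
  -- Convexity of the strip makes the derivative bound a global Lipschitz bound, hence `U` injective
  -- on the whole strip.
  exact Convex.lipschitzOnWith_of_nnnorm_fderiv_le (𝕜 := ℂ)
    (fun θ hθ => (u.hasFDerivAt hs.out hθ).differentiableAt)
    (fun θ hθ => norm_fderiv_apply_le u hθ) (convex_strip d s)

theorem IsAdmissible.pullback_eq (h : IsAdmissible s r σ m ‖ω‖)
    (hX : ‖X - constField 1 r ω‖ < σ * m / 26) {θ : Vec d} (hθ : θ ∈ strip d s) :
    (fderiv ℂ (fun θ => θ + h.displacement X θ) θ).IsInvertible ∧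
      h.normalForm X θ = pullback (fun θ => θ + h.displacement X θ) X θ := by
  have hm := h.pos
  have h1 := (h.displacement_spec hX).1
  have hinv := isInvertible_one_add_fderiv (by linarith [h.le_tenth] :
    ‖h.displacement X‖ < 1) hθ
  rw [pullback, (hasFDerivAt_id_add (h.displacement X) hθ).fderiv]
  refine ⟨hinv, (hinv.inverse_apply_eq.mpr ?_).symm⟩
  have h2 := congrArg (evalL 0 hs.out hθ) (h.normalForm_add hX)
  rw [map_add, evalL_apply, evalL_apply, evalL_apply, jacobianOp_apply _ _ hθ,
    compOp_apply h.lt (by linarith [h.le_strip]) _ hθ] at h2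
  exact h2.symm

theorem IsAdmissible.fourierProj_normalForm (h : IsAdmissible s r σ m ‖ω‖) (X : A' d r)
    (θ : Vec d) : fourierProj (farIndices σ ω) (h.normalForm X) θ = 0 := by
  rw [fourierProj]
  convert! tsum_zero with k
  rw [← h.projOp_normalForm, coeff_projOp, Set.indicator_of_notMem (not_not_intro k.2), smul_zero]

/-- The projected series is itself a field, and a field that vanishes on the strip has zero
coefficients. -/
theorem coeff_eq_zero_of_fourierProj {j : ℕ} {I : Set (Fin d → ℤ)} (f : FieldSpace d j s)
    (h : ∀ θ ∈ strip d s, fourierProj I f θ = 0) (k : Fin d → ℤ) (hk : k ∈ I) :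
    coeff f k = 0 := by
  have h0 : projOp le_rfl j I f = 0 :=
    FieldSpace.ext_strip fun θ hθ => (projOp_apply le_rfl j I f hθ).trans (h θ hθ)
  have h1 := coeff_projOp le_rfl j I f k
  rw [h0, Set.indicator_of_mem hk] at h1
  rw [← h1]
  exact coeff_zero k

end

/-! ### Numerical constants. -/

theorem isAdmissible_min {ρ ρ' σ w : ℝ} (hρ : ρ' < ρ) (hσ : 0 < σ) (hσw : σ < w) :
    IsAdmissible ρ' ρ σ (min ((ρ - ρ') / (4 * Real.pi)) ((3 - √6) / 6 * (σ / w))) w := by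
  have h6 : (√6) ^ 2 = 6 := Real.sq_sqrt (by norm_num)
  have h60 : 0 ≤ √6 := Real.sqrt_nonneg 6
  -- This gives `(3 - √6)/6 < 1/10`, the source of both bounds with a tenth.
  have h1 : 2.4 < √6 := by nlinarith
  have h2 : √6 < 3 := by nlinarith
  have hw : 0 < w := hσ.trans hσw
  have h3 : (3 - √6) / 6 * (σ / w) ≤ 1 / 10 * (σ / w) :=
    mul_le_mul_of_nonneg_right (by linarith) (by positivity)
  refine ⟨hρ, hσ, lt_min (div_pos (sub_pos.mpr hρ) (by positivity)) ?_, min_le_left _ _, ?_, ?_⟩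
  · have : 0 < 3 - √6 := by linarith
    positivity
  · refine (min_le_right _ _).trans (h3.trans ?_)
    have : σ / w ≤ 1 := (div_le_one hw).mpr hσw.le
    linarith
  · refine (mul_le_mul_of_nonneg_right ((min_le_right _ _).trans h3) hw.le).trans (le_of_eq ?_)
    field_simp

/-- From `√6 < 2.46` one gets `(√6 - 2)/12 < 1/26`, so the fixed point argument covers the whole
ball of vector fields. -/
theorem radius_le {ρ ρ' σ w : ℝ} (hρ : ρ' < ρ) (hσ : 0 < σ) (hσw : σ < w) :
    radius ρ ρ' σ w ≤
      σ * min ((ρ - ρ') / (4 * Real.pi)) ((3 - √6) / 6 * (σ / w)) / 26 := by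
  have hm := (isAdmissible_min hρ hσ hσw).pos
  have h6 : (√6) ^ 2 = 6 := Real.sq_sqrt (by norm_num)
  have h2 : √6 < 2.46 := by nlinarith [Real.sqrt_nonneg 6]
  rw [radius]
  set m := min ((ρ - ρ') / (4 * Real.pi)) ((3 - √6) / 6 * (σ / w))
  have h3 : (√6 - 2) / 12 ≤ 1 / 26 := by linarith
  calc _ ≤ 1 / 26 * σ * m := by gcongr
    _ = _ := by ring

end TorusField

/-! ### The normal form theorem. -/

open TorusField

theorem theorem5p2 (d : ℕ) (ρ ρ' σ : ℝ) (ω : Vec d) (hρ' : 0 < ρ') (hρ : ρ' < ρ)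
    (hω : ω ≠ 0) (hσ : 0 < σ) (hσω : σ < ‖ω‖) :
    ∃ (U : A' d ρ → Vec d → Vec d) (𝒰 : A' d ρ → A d ρ'),
      (∀ X ∈ Metric.ball (constField 1 ρ ω : A' d ρ) (radius ρ ρ' σ ‖ω‖),
        IsCoordChange (U X) (strip d ρ') (strip d ρ) ∧
        (∃ u : A' d ρ', (∀ θ ∈ strip d ρ', U X θ = θ + u θ) ∧
          ‖u‖ ≤ 6 * (√6 + 2) / σ * ‖X - constField 1 ρ ω‖) ∧
        (∀ θ ∈ strip d ρ', (fderiv ℂ (U X) θ).IsInvertible ∧ 𝒰 X θ = pullback (U X) X θ) ∧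
        (∀ θ ∈ strip d ρ', fourierProj (farIndices σ ω) (𝒰 X) θ = 0) ∧
        ((∀ θ ∈ strip d ρ, fourierProj (farIndices σ ω) X θ = 0) →
          ∀ θ ∈ strip d ρ', U X θ = θ) ∧
        ‖𝒰 X - constField 0 ρ' ω‖ ≤
          2 * (1 + max (2 / 3 * (3 - √6)) (6 * (√6 + 2) * (‖ω‖ / σ))) *
            ‖X - constField 1 ρ ω‖) ∧
      AnalyticOnNhd ℂ 𝒰 (Metric.ball (constField 1 ρ ω : A' d ρ) (radius ρ ρ' σ ‖ω‖)) ∧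
      ∀ ψ : Vec d,
        (constField 1 ρ (ω + ψ) : A' d ρ) ∈
            Metric.ball (constField 1 ρ ω : A' d ρ) (radius ρ ρ' σ ‖ω‖) →
          ∃ L : A' d ρ →L[ℂ] A d ρ',
            (∀ (h : A' d ρ), ∀ θ ∈ strip d ρ', L h θ = fourierProj (resonantIndices σ ω) h θ) ∧
            HasFDerivAt 𝒰 L (constField 1 ρ (ω + ψ)) := by
  have : Fact (0 < ρ') := ⟨hρ'⟩
  have : Fact (0 < ρ) := ⟨hρ'.trans hρ⟩
  have h := isAdmissible_min hρ hσ hσω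
  have hball : ∀ X ∈ Metric.ball (constField 1 ρ ω : A' d ρ) (radius ρ ρ' σ ‖ω‖),
      ‖X - constField 1 ρ ω‖ <
        σ * min ((ρ - ρ') / (4 * Real.pi)) ((3 - √6) / 6 * (σ / ‖ω‖)) / 26 := by
    intro X hX
    rw [Metric.mem_ball, dist_eq_norm] at hX
    exact hX.trans_le (radius_le hρ hσ hσω)
  have hm := h.pos
  refine ⟨fun X θ => θ + h.displacement X θ, h.normalForm, fun X hX => ?_, fun X hX => ?_,
    fun ψ hψ => ⟨projOp hρ.le 1 (resonantIndices σ ω),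
      fun f θ hθ => projOp_apply hρ.le 1 _ f hθ, h.hasFDerivAt_normalForm _ (hball _ hψ)⟩⟩
  · have hX' := hball X hX
    have h1 := (h.displacement_spec hX').1
    refine ⟨isCoordChange_id_add hρ (by linarith [h.le_strip]) (by linarith [h.le_tenth]),
      ⟨h.displacement X, fun _ _ => rfl, (h.norm_displacement_le hX').trans ?_⟩,
      fun θ hθ => h.pullback_eq hX' hθ, fun θ _ => h.fourierProj_normalForm X θ, fun h0 θ _ => ?_,
      (h.norm_normalForm_sub_le hX').trans ?_⟩
    · have : 6 * (√6 + 2) / σ * ‖X - constField 1 ρ ω‖ =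
          6 * (√6 + 2) * (‖X - constField 1 ρ ω‖ / σ) := by ring
      rw [this]
      -- The bound obtained has the constant `3`, well below `6 (√6 + 2)`.
      refine mul_le_mul_of_nonneg_right ?_ (by positivity)
      linarith [Real.sqrt_nonneg 6]
    · change θ + h.displacement X θ = θ
      rw [h.displacement_eq_zero hX' (coeff_eq_zero_of_fourierProj X h0)]
      simp
    · refine mul_le_mul_of_nonneg_right ?_ (norm_nonneg _)
      -- The constant `2` obtained above already suffices, so only the sign of the maximum matters.
      have : 0 ≤ max (2 / 3 * (3 - √6)) (6 * (√6 + 2) * (‖ω‖ / σ)) :=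
        le_max_of_le_right (by positivity)
      linarith
  · exact (h.contDiffAt_normalForm (hball X hX)).analyticAt
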